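/- **Setting.** Let $\mathcal S$ be a measurable state space, $\mathcal A$ a finite action space with $|\mathcal A|=K$, and $H\ge 1$ a horizon. A task $\mu$ is a finite-horizon Markov decision process on $(\mathcal S,\mathcal A)$ with initial state distribution $\nu_\mu$, transition function $P_\mu:\mathcal S\times\mathcal A\to\Delta(\mathcal S)$, cost function $C_\mu:\mathcal S\times\mathcal A\to\mathbb R$ bounded by one, $|C_\mu(s,a)|\le 1$, and a stationary expert policy $\pi^*_\mu:\mathcal S\to\Delta(\mathcal A)$. Tasks depend measurably on $\mu$ and are drawn from a probability distribution $\eta$. For a stationary policy $\pi$ let $J_\mu(\pi)=\mathbb E\big[\sum_{h=1}^H C_\mu(s_h,a_h)\big]$, where $s_1\sim\nu_\mu$, $a_h\sim\pi(s_h)$, $s_{h+1}\sim P_\mu(\cdot\mid s_h,a_h)$. Let $\nu^*_{h,\mu}$ be the law of $s_h$ under $\pi^*_\mu$, and write $(s,a)\sim\mu$ for $s\sim\frac1H\sum_{h=1}^H\nu^*_{h,\mu}$, $a\sim\pi^*_\mu(s)$. Let $\Phi$ be a class of measurable functions $\phi:\mathcal S\to\mathbb R^d$ with $\|\phi(s)\|_2\le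 R$ for all $s$; as usual, assume that $\Phi$ has a countable subclass such that each $\phi\in\Phi$ is the pointwise limit of a sequence in it. For $\phi\in\Phi$ let $\Pi^\phi$ be the set of policies $\pi(s)=\mathrm{softmax}(W\phi(s))$ with $W\in\mathbb R^{K\times d}$, $\|W\|_F\le 1$. For ${\bf x}=\{(s_j,a_j)\}_{j=1}^n$ let $\ell^{\bf x}(\pi)=\frac1n\sum_{j=1}^n-\log\big(\pi(s_j)_{a_j}\big)$ and let $\pi^{\phi,{\bf x}}\in\arg\min_{\pi\in\Pi^\phi}\ell^{\bf x}(\pi)$ (behavioral cloning on top of $\phi$; ties are broken in any measurable way). The training data ${\bf X}=({\bf x}^{(1)},\dots,{\bf x}^{(T)})$, $T,n\ge1$, consist of $n$ i.i.d. samples ${\bf x}^{(t)}\sim(\mu^{(t)})^n$ for each of $T$ i.i.d. tasks $\mu^{(t)}\sim\eta$; ${\bf S}=\{s^t_j\}$ are the states in ${\bf X}$, and $$\hat L(\phi)=\frac1T\sum_{t=1}^T\min_{\pi\in\Pi^\phi}\ell^{{\bf x}^{(t)}}(\pi),\qquad G(\Phi({\bf S}))=\mathbb E_g\Big[\sup_{\phi\in\Phi}\sum_{i,t,j}g_{itj}\,\phi_i(s^t_j)\Big],$$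 with $g_{itj}$ independent standard normal variables. **Theorem.** There are universal constants $c,c',c''>0$ such that the following holds. Assume that 1. for $\eta$-almost every $\mu$ the expert policy $\pi^*_\mu$ is deterministic, and 2. for some $\gamma<1/2$ there is $\phi^*\in\Phi$ such that for $\eta$-almost every $\mu$ there is $\pi_\mu\in\Pi^{\phi^*}$ with $\pi_\mu(s)_{\pi^*_\mu(s)}\ge 1-\gamma$ for all $s\in\mathcal S$. Let $0<\delta<1$. Then with probability at least $1-\delta$ over the sampling of ${\bf X}$, every $\hat\phi\in\arg\min_{\phi\in\Phi}\hat L(\phi)$ satisfies $$\mathop{\mathbb E}_{\mu\sim\eta}\mathop{\mathbb E}_{{\bf x}\sim\mu^n}J_\mu(\pi^{\hat\phi,{\bf x}})-\mathop{\mathbb E}_{\mu\sim\eta}J_\mu(\pi^*_\mu)\le H^2(2\gamma+\epsilon_{gen}),\qquad \epsilon_{gen}=c\,\frac{G(\Phi({\bf S}))}{T\sqrt n}+c'\,\frac{R\sqrt K}{\sqrt n}+c''\sqrt{\frac{\ln(4/\delta)}{T}}.$$ -/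

import Mathlib

open MeasureTheory ProbabilityTheory Filter Topology
open scoped Matrix ENNReal

noncomputable section

namespace BehavioralCloning

/-- Value of a stationary policy `π` in an MDP with transition `P` and cost `C`, with `k` steps to
go: the expectation of the sum of the next `k` costs when `a ∼ π(s)` and `s' ∼ P(s, a)`. -/
def value {S A : Type*} [MeasurableSpace S] [MeasurableSpace A]
    (P : S → A → Measure S) (C : S → A → ℝ) (π : S → Measure A) : ℕ → S → ℝ
  | 0, _ => 0
  | k + 1, s => ∫ a, (C s a + ∫ s', value P C π k s' ∂(P s a)) ∂(π s)

/-- A measurable family, indexed by `M`, of tasks on the state space `S` and the action space `A`.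
Each task is an MDP (initial state distribution, transition, cost) with a stationary, possibly
stochastic, expert policy. -/
structure TaskFamily (M S A : Type*) [MeasurableSpace M] [MeasurableSpace S]
    [MeasurableSpace A] where
  /-- initial state distribution of each task -/
  init : Kernel M S
  /-- transition function of each task -/
  trans : Kernel (M × S × A) S
  /-- expert policy of each task -/
  expert : Kernel (M × S) A
  /-- cost function of each task -/
  cost : M → S → A → ℝ
  markov_init : IsMarkovKernel init
  markov_trans : IsMarkovKernel trans
  markov_expert : IsMarkovKernel expert
  measurable_cost : Measurable fun p : M × S × A => cost p.1 p.2.1 p.2.2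

attribute [instance] TaskFamily.markov_init TaskFamily.markov_trans TaskFamily.markov_expert

namespace TaskFamily

variable {M S A : Type*} [MeasurableSpace M] [MeasurableSpace S] [MeasurableSpace A]

/-- The expected total cost `J_m(π)` over horizon `H` of the stationary policy `π` on task `m`. -/
def J (F : TaskFamily M S A) (H : ℕ) (m : M) (π : S → Measure A) : ℝ :=
  ∫ s, value (fun s a => F.trans (m, s, a)) (F.cost m) π H s ∂(F.init m)

/-- The expert policy of task `m`. -/
def expertPolicy (F : TaskFamily M S A) (m : M) : S → Measure A := fun s => F.expert (m, s)

/-- The law of the state that the expert of each task visits at level `h`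
(levels are counted from `0`). -/
def expertStateLaw (F : TaskFamily M S A) : ℕ → Kernel M S
  | 0 => F.init
  | h + 1 => Kernel.snd ((expertStateLaw F h ⊗ₖ F.expert) ⊗ₖ F.trans)

/-- The law of one expert sample of task `m`: a pair `(s, a)` with `s` drawn from the average over
the levels of the expert's state distributions, and `a` from the expert policy at `s`. -/
def sampleLaw (F : TaskFamily M S A) (H : ℕ) (m : M) : Measure (S × A) :=
  (H : ℝ≥0∞)⁻¹ • ∑ h ∈ Finset.range H, (F.expertStateLaw h ⊗ₖ F.expert) m

/-- The law of `n` i.i.d. expert samples of task `m`. -/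
def taskDataLaw (F : TaskFamily M S A) (H n : ℕ) (m : M) : Measure (Fin n → S × A) :=
  Measure.pi fun _ => F.sampleLaw H m

/-- The law of the training data: `T` tasks are drawn independently from `η`, and for each of them
`n` expert samples are drawn. -/
def trainDataLaw (F : TaskFamily M S A) (η : Measure M) (H n T : ℕ) :
    Measure (Fin T → Fin n → S × A) :=
  Measure.pi fun _ => η.bind (F.taskDataLaw H n)

end TaskFamily

/-- The softmax of a vector. -/
def softmax {A : Type*} [Fintype A] (v : A → ℝ) (a : A) : ℝ :=
  Real.exp (v a) / ∑ b, Real.exp (v b)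

section Learning

variable {S A : Type*} [MeasurableSpace S] [Fintype A] [MeasurableSpace A] {d : ℕ}

/-- The stationary policy that plays `a` at state `s` with probability `softmax (W φ(s))_a`. -/
def softmaxPolicy (φ : S → EuclideanSpace ℝ (Fin d)) (W : Matrix A (Fin d) ℝ) (s : S) :
    Measure A :=
  ∑ a, ENNReal.ofReal (softmax (W *ᵥ (φ s).ofLp) a) • Measure.dirac a

/-- The class of linear-softmax policies on top of `φ`, with Frobenius norm of the weights at
most `1`. -/
def policyClass (A : Type*) [Fintype A] [MeasurableSpace A]
    (φ : S → EuclideanSpace ℝ (Fin d)) : Set (S → Measure A) :=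
  {π | ∃ W : Matrix A (Fin d) ℝ, √(∑ a, ∑ i, W a i ^ 2) ≤ 1 ∧ π = softmaxPolicy φ W}

/-- The logistic loss of a distribution on actions at the action `a`. -/
def logisticLoss (p : Measure A) (a : A) : ℝ := -Real.log (p.real {a})

/-- The empirical logistic loss of a policy on the samples `x`. -/
def empLoss {n : ℕ} (π : S → Measure A) (x : Fin n → S × A) : ℝ :=
  (1 / (n : ℝ)) * ∑ j, logisticLoss (π (x j).1) (x j).2

/-- The empirical bi-level loss of a representation: the average over the tasks of the smallest
empirical loss of a policy on top of it. -/
def bilevelLoss {n T : ℕ} (X : Fin T → Fin n → S × A) (φ : S → EuclideanSpace ℝ (Fin d)) : ℝ :=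
  (1 / (T : ℝ)) * ∑ t, sInf ((fun π => empLoss π (X t)) '' policyClass A φ)

/-- `bc` is behavioral cloning on top of `φ`: it maps a sample to a policy on top of `φ` of
smallest empirical loss, ties being broken in any measurable way. -/
structure IsCloning {n : ℕ} (φ : S → EuclideanSpace ℝ (Fin d))
    (bc : (Fin n → S × A) → S → Measure A) : Prop where
  measurable : Measurable fun p : (Fin n → S × A) × S => bc p.1 p.2
  mem : ∀ x, bc x ∈ policyClass A φ
  min : ∀ x, ∀ π ∈ policyClass A φ, empLoss (bc x) x ≤ empLoss π x

end Learning

/-- The Gaussian average of the class `Φ` on the points `p`. -/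
def gaussianAverage {S ι : Type*} [Fintype ι] {d : ℕ} (Φ : Set (S → EuclideanSpace ℝ (Fin d)))
    (p : ι → S) : ℝ :=
  ∫ g : Fin d × ι → ℝ, (⨆ φ : Φ, ∑ k : Fin d × ι, g k * φ.1 (p k.2) k.1)
    ∂(Measure.pi fun _ => gaussianReal 0 1)

/-- The usual measurability condition on a class of functions, under which suprema over it may be
taken over a countable subclass: its members are measurable, and each of them is the pointwise
limit of a sequence in a fixed countable subclass. -/
def PointwiseMeasurable {S E : Type*} [MeasurableSpace S] [MeasurableSpace E] [TopologicalSpace E]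
    (Φ : Set (S → E)) : Prop :=
  (∀ φ ∈ Φ, Measurable φ) ∧
    ∃ Φ₀ ⊆ Φ, Φ₀.Countable ∧ ∀ φ ∈ Φ, ∃ u : ℕ → S → E,
      (∀ k, u k ∈ Φ₀) ∧ ∀ s, Tendsto (fun k => u k s) atTop (𝓝 (φ s))

end BehavioralCloning

end

noncomputable section

namespace BehavioralCloning

section Integrals

variable {Z : Type*} [MeasurableSpace Z]

lemma measurePreserving_cons (P : Measure Z) [IsProbabilityMeasure P] (N : ℕ) :
    MeasurePreserving (fun p : Z × (Fin N → Z) => (Fin.cons p.1 p.2 : Fin (N + 1) → Z))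
      (P.prod (Measure.pi fun _ => P)) (Measure.pi fun _ => P) := by
  have h := (measurePreserving_piFinSuccAbove (fun _ : Fin (N + 1) => P) 0).symm
  convert h using 1
  funext p
  simp [MeasurableEquiv.piFinSuccAbove, Fin.insertNthEquiv]

lemma measurableEmbedding_cons (N : ℕ) :
    MeasurableEmbedding (fun p : Z × (Fin N → Z) => (Fin.cons p.1 p.2 : Fin (N + 1) → Z)) := by
  have h := (MeasurableEquiv.piFinSuccAbove (fun _ : Fin (N + 1) => Z) 0).symm.measurableEmbedding
  convert h using 1
  funext p
  simp [MeasurableEquiv.piFinSuccAbove, Fin.insertNthEquiv]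

lemma integrable_cons_iff (P : Measure Z) [IsProbabilityMeasure P] {N : ℕ}
    {f : (Fin (N + 1) → Z) → ℝ} :
    Integrable (fun p : Z × (Fin N → Z) => f (Fin.cons p.1 p.2)) (P.prod (Measure.pi fun _ => P))
      ↔ Integrable f (Measure.pi fun _ => P) :=
  (measurePreserving_cons P N).integrable_comp_emb (measurableEmbedding_cons N)

lemma integral_pi_succ (P : Measure Z) [IsProbabilityMeasure P] {N : ℕ}
    {f : (Fin (N + 1) → Z) → ℝ} (hf : Integrable f (Measure.pi fun _ => P)) :
    ∫ z, f z ∂(Measure.pi fun _ => P)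
      = ∫ y, ∫ w, f (Fin.cons y w) ∂(Measure.pi fun _ => P) ∂P := by
  rw [← (measurePreserving_cons P N).integral_comp (measurableEmbedding_cons N),
    integral_prod _ ((integrable_cons_iff P).2 hf)]

lemma integral_pi_succ_symm (P : Measure Z) [IsProbabilityMeasure P] {N : ℕ}
    {f : (Fin (N + 1) → Z) → ℝ} (hf : Integrable f (Measure.pi fun _ => P)) :
    ∫ z, f z ∂(Measure.pi fun _ => P)
      = ∫ w, ∫ y, f (Fin.cons y w) ∂P ∂(Measure.pi fun _ => P) := by
  rw [← (measurePreserving_cons P N).integral_comp (measurableEmbedding_cons N),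
    integral_prod_symm _ ((integrable_cons_iff P).2 hf)]

lemma integrable_of_abs_le {Ω : Type*} [MeasurableSpace Ω] {μ : Measure Ω} [IsFiniteMeasure μ]
    {f : Ω → ℝ} (hf : Measurable f) {B : ℝ} (hB : ∀ z, |f z| ≤ B) : Integrable f μ :=
  Integrable.of_bound hf.aestronglyMeasurable B (ae_of_all _ hB)

lemma abs_exp_mul_le (l : ℝ) {x B : ℝ} (h : |x| ≤ B) : |Real.exp (l * x)| ≤ Real.exp (|l| * B) := by
  rw [abs_of_pos (Real.exp_pos _), Real.exp_le_exp]
  calc l * x ≤ |l * x| := le_abs_self _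
    _ = |l| * |x| := abs_mul _ _
    _ ≤ |l| * B := by gcongr

lemma abs_ciSup_le {I : Type*} [Nonempty I] {f : I → ℝ} {B : ℝ} (h : ∀ i, |f i| ≤ B) :
    |⨆ i, f i| ≤ B := by
  have hb : BddAbove (Set.range f) := ⟨B, by rintro _ ⟨i, rfl⟩; exact (abs_le.1 (h i)).2⟩
  obtain ⟨i⟩ := ‹Nonempty I›
  exact abs_le.2 ⟨(abs_le.1 (h i)).1.trans (le_ciSup hb i), ciSup_le fun i => (abs_le.1 (h i)).2⟩

lemma bddAbove_range_of_abs_le {I : Type*} {f : I → ℝ} {B : ℝ} (h : ∀ i, |f i| ≤ B) :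
    BddAbove (Set.range f) := ⟨B, by rintro _ ⟨i, rfl⟩; exact (abs_le.1 (h i)).2⟩

lemma integrable_iSup {Ω I : Type*} [MeasurableSpace Ω] {μ : Measure Ω} [Countable I] [Nonempty I]
    {f : I → Ω → ℝ} (hf : ∀ i, Measurable (f i)) {G : Ω → ℝ} (hG : Integrable G μ)
    (h : ∀ i ω, |f i ω| ≤ G ω) : Integrable (fun ω => ⨆ i, f i ω) μ := by
  refine hG.mono' (Measurable.iSup hf).aestronglyMeasurable (ae_of_all _ fun ω => ?_)
  exact abs_ciSup_le fun i => h i ω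

end Integrals

section BoundedDifferences

variable {Z : Type*} [MeasurableSpace Z]

lemma integral_exp_le_of_sub_le {Ω : Type*} [MeasurableSpace Ω] (μ : Measure Ω)
    [IsProbabilityMeasure μ] {g : Ω → ℝ} (hg : Measurable g) {c : ℝ}
    (hd : ∀ x y, g x - g y ≤ c) (l : ℝ) :
    ∫ x, Real.exp (l * g x) ∂μ ≤ Real.exp (l * ∫ x, g x ∂μ + c ^ 2 * l ^ 2 / 8) := by
  have hne : Nonempty Ω := μ.nonempty_of_neZero
  obtain ⟨x₀⟩ := id hne
  have hc : 0 ≤ c := by simpa using hd x₀ x₀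
  have hbd : BddBelow (Set.range g) := ⟨g x₀ - c, by rintro _ ⟨x, rfl⟩; linarith [hd x₀ x]⟩
  set a := ⨅ x, g x
  have hmem : ∀ x, g x ∈ Set.Icc a (a + c) := fun x => by
    refine ⟨ciInf_le hbd x, ?_⟩
    have : g x - c ≤ a := le_ciInf fun y => by linarith [hd x y]
    linarith
  have h := (hasSubgaussianMGF_of_mem_Icc (μ := μ) hg.aemeasurable (ae_of_all _ hmem)).mgf_le l
  have hr : ((‖a + c - a‖₊ / 2) ^ 2 : NNReal) = (c ^ 2 / 4 : ℝ) := by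
    rw [add_sub_cancel_left]
    push_cast
    rw [ Real.norm_eq_abs, abs_of_nonneg hc]
    ring
  rw [mgf] at h
  calc ∫ x, Real.exp (l * g x) ∂μ
      = ∫ x, Real.exp (l * ∫ x, g x ∂μ) * Real.exp (l * (g x - ∫ x, g x ∂μ)) ∂μ := by
        congr 1; funext x; rw [← Real.exp_add]; congr 1; ring
    _ ≤ Real.exp (l * ∫ x, g x ∂μ) * Real.exp (c ^ 2 * l ^ 2 / 8) := by
        rw [integral_const_mul]
        gcongr
        refine h.trans (le_of_eq ?_)
        congr 1
        rw [hr]; ring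
    _ = _ := by rw [← Real.exp_add]

/-- A function on a product space whose values change by at most `c` when one coordinate is
changed is sub-Gaussian. -/
theorem integral_exp_le_of_bounded_differences (P : Measure Z) [IsProbabilityMeasure P] {c : ℝ}
    (l : ℝ) (N : ℕ) (f : (Fin N → Z) → ℝ) (hf : Measurable f) (hB : ∃ B, ∀ z, |f z| ≤ B)
    (hd : ∀ z z' t, (∀ s, s ≠ t → z s = z' s) → f z - f z' ≤ c) :
    ∫ z, Real.exp (l * f z) ∂(Measure.pi fun _ => P)
      ≤ Real.exp (l * ∫ z, f z ∂(Measure.pi fun _ => P) + N * c ^ 2 * l ^ 2 / 8) := by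
  induction N with
  | zero =>
    have : ∀ z, f z = f default := fun z => congrArg f (Subsingleton.elim _ _)
    simp [this]
  | succ N ih =>
    obtain ⟨B, hB⟩ := hB
    have hcons : Measurable fun p : Z × (Fin N → Z) => f (Fin.cons p.1 p.2) :=
      hf.comp (measurableEmbedding_cons N).measurable
    have hexp : ∀ z, |Real.exp (l * f z)| ≤ Real.exp (|l| * B) := fun z => abs_exp_mul_le l (hB z)
    have hfi : Integrable f (Measure.pi fun _ => P) := integrable_of_abs_le hf hB
    have hei : Integrable (fun z => Real.exp (l * f z)) (Measure.pi fun _ : Fin (N + 1) => P) :=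
      integrable_of_abs_le (by fun_prop) hexp
    set g : Z → ℝ := fun y => ∫ w, f (Fin.cons y w) ∂(Measure.pi fun _ => P) with hgdef
    have hg : Measurable g := hcons.stronglyMeasurable.integral_prod_right.measurable
    have hgB : ∀ y, |g y| ≤ B := fun y => by
      simpa using norm_integral_le_of_norm_le_const (μ := Measure.pi fun _ : Fin N => P)
        (f := fun w => f (Fin.cons y w)) (ae_of_all _ fun w => hB _)
    rw [integral_pi_succ P hei, integral_pi_succ P hfi]
    have hcy : ∀ y, Measurable fun w : Fin N → Z => f (Fin.cons y w) := fun y =>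
      hcons.comp (measurable_const.prodMk measurable_id)
    have key : ∀ y, ∫ w, Real.exp (l * f (Fin.cons y w)) ∂(Measure.pi fun _ => P)
        ≤ Real.exp (N * c ^ 2 * l ^ 2 / 8) * Real.exp (l * g y) := fun y => by
      rw [← Real.exp_add, add_comm (_ / 8)]
      refine ih (fun w => f (Fin.cons y w)) (hcy y) ⟨B, fun w => hB _⟩ ?_
      intro z z' t h
      refine hd _ _ t.succ fun s hs => ?_
      refine Fin.cases ?_ (fun s hs => ?_) s hs
      · simp
      · simpa using h s (fun h => hs (by rw [h]))
    have hgd : ∀ x y, g x - g y ≤ c := fun x y => by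
      rw [hgdef]
      simp only
      rw [← integral_sub (integrable_of_abs_le (hcy x) fun w => hB _)
        (integrable_of_abs_le (hcy y) fun w => hB _)]
      calc _ ≤ ∫ w : Fin N → Z, c ∂(Measure.pi fun _ => P) := by
            refine integral_mono ((integrable_of_abs_le (hcy x) fun w => hB _).sub
              (integrable_of_abs_le (hcy y) fun w => hB _)) (integrable_const _) fun w => ?_
            refine hd _ _ 0 fun s hs => ?_
            refine Fin.cases (fun h => absurd rfl h) (fun s _ => ?_) s hs
            simp
        _ = c := by simp
    calc _ ≤ ∫ y, Real.exp (N * c ^ 2 * l ^ 2 / 8) * Real.exp (l * g y) ∂P := by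
          refine integral_mono ((integrable_cons_iff P).2 hei).integral_prod_left ?_ key
          refine (integrable_of_abs_le (B := Real.exp (|l| * B)) (by fun_prop) fun y =>
            abs_exp_mul_le l (hgB y)).const_mul _
      _ ≤ Real.exp (N * c ^ 2 * l ^ 2 / 8) * Real.exp (l * ∫ x, g x ∂P + c ^ 2 * l ^ 2 / 8) := by
          rw [integral_const_mul]
          gcongr
          exact integral_exp_le_of_sub_le P hg hgd l
      _ = _ := by
          rw [← Real.exp_add]
          congr 1
          push_cast
          ring

/-- The bounded differences inequality, for a function of nonpositive mean. -/
theorem measure_ge_le_of_bounded_differences (P : Measure Z) [IsProbabilityMeasure P] {c : ℝ}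
    (hc : 0 < c) {N : ℕ} (hN : 0 < N) (f : (Fin N → Z) → ℝ) (hf : Measurable f)
    (hB : ∃ B, ∀ z, |f z| ≤ B)
    (hd : ∀ z z' t, (∀ s, s ≠ t → z s = z' s) → f z - f z' ≤ c)
    (hmean : ∫ z, f z ∂(Measure.pi fun _ => P) ≤ 0) {u : ℝ} (hu : 0 ≤ u) :
    (Measure.pi fun _ => P) {z | u ≤ f z} ≤ ENNReal.ofReal (Real.exp (-2 * u ^ 2 / (N * c ^ 2))) := by
  obtain ⟨B, hB'⟩ := hB
  have hN' : (0 : ℝ) < N := by exact_mod_cast hN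
  set l : ℝ := 4 * u / (N * c ^ 2) with hl
  have hl0 : 0 ≤ l := by positivity
  have hei : Integrable (fun z => Real.exp (l * f z)) (Measure.pi fun _ : Fin N => P) := by
    refine integrable_of_abs_le (B := Real.exp (l * B)) (by fun_prop) fun z => ?_
    rw [abs_of_pos (Real.exp_pos _)]
    gcongr
    exact (abs_le.1 (hB' z)).2
  have h := measure_ge_le_exp_mul_mgf (X := f) (μ := Measure.pi fun _ : Fin N => P) u hl0 hei
  rw [← ENNReal.ofReal_toReal (measure_ne_top (Measure.pi fun _ : Fin N => P) {z | u ≤ f z})]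
  refine ENNReal.ofReal_le_ofReal (h.trans ?_)
  have h2 := integral_exp_le_of_bounded_differences P l N f hf ⟨B, hB'⟩ hd
  rw [mgf]
  calc _ ≤ Real.exp (-l * u) * Real.exp (N * c ^ 2 * l ^ 2 / 8) := by
        gcongr
        refine h2.trans (Real.exp_le_exp.2 ?_)
        linarith [mul_nonpos_of_nonneg_of_nonpos hl0 hmean]
    _ = _ := by
        rw [← Real.exp_add]
        congr 1
        rw [hl]
        field_simp
        ring

end BoundedDifferences

section Gaussian

variable {ι : Type*} [Fintype ι]

/-- The law of a family of independent standard normal variables. -/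
abbrev stdNormal (ι : Type*) [Fintype ι] : Measure (ι → ℝ) := Measure.pi fun _ => gaussianReal 0 1

lemma map_sum_mul_stdNormal (u : ι → ℝ) :
    (stdNormal ι).map (fun g => ∑ k, g k * u k) = gaussianReal 0 (∑ k, u k ^ 2).toNNReal := by
  apply Measure.ext_of_charFun
  funext t
  rw [charFun_gaussianReal, charFun_apply_real,
    integral_map (Measurable.aemeasurable (by fun_prop)) (by fun_prop)]
  have : ∀ g : ι → ℝ, Complex.exp (t * (∑ k, g k * u k : ℝ) * Complex.I)
      = ∏ k, Complex.exp ((t * u k : ℝ) * (g k : ℝ) * Complex.I) := fun g => by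
    rw [← Complex.exp_sum]
    congr 1
    push_cast
    rw [Finset.mul_sum, Finset.sum_mul]
    exact Finset.sum_congr rfl fun k _ => by ring
  simp_rw [this]
  rw [integral_fintype_prod_eq_prod (μ := fun _ : ι => gaussianReal 0 1)
    (f := fun k x => Complex.exp ((t * u k : ℝ) * (x : ℝ) * Complex.I))]
  simp_rw [← charFun_apply_real, charFun_gaussianReal]
  rw [← Complex.exp_sum]
  congr 1
  rw [Real.coe_toNNReal _ (Finset.sum_nonneg fun k _ => sq_nonneg _)]
  push_cast
  rw [Finset.sum_mul]
  simp
  rw [Finset.sum_div]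
  exact Finset.sum_congr rfl fun k _ => by ring

lemma integral_sq_sum_mul_stdNormal (u : ι → ℝ) :
    ∫ g, (∑ k, g k * u k) ^ 2 ∂(stdNormal ι) = ∑ k, u k ^ 2 := by
  have h : ∫ x, x ^ 2 ∂((stdNormal ι).map fun g => ∑ k, g k * u k) = ∑ k, u k ^ 2 := by
    rw [map_sum_mul_stdNormal]
    have h := variance_fun_id_gaussianReal (μ := 0) (v := (∑ k, u k ^ 2).toNNReal)
    rw [variance_of_integral_eq_zero (by fun_prop) (by simp)] at h
    rw [h, Real.coe_toNNReal _ (Finset.sum_nonneg fun k _ => sq_nonneg _)]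
  rw [← h, integral_map (Measurable.aemeasurable (by fun_prop)) (by fun_prop)]

lemma integrable_eval_stdNormal (k : ι) : Integrable (fun g : ι → ℝ => g k) (stdNormal ι) :=
  integrable_comp_eval (f := id) ((memLp_id_gaussianReal 1).integrable le_rfl)

lemma memLp_eval_stdNormal (k : ι) : MemLp (fun g : ι → ℝ => g k) 2 (stdNormal ι) :=
  (memLp_id_gaussianReal 2).comp_measurePreserving (measurePreserving_eval _ k)

lemma integrable_abs_sum_mul_stdNormal (u : ι → ℝ) :
    Integrable (fun g : ι → ℝ => |∑ k, g k * u k|) (stdNormal ι) :=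
  (integrable_finsetSum _ fun k _ => (integrable_eval_stdNormal k).mul_const _).abs

lemma one_third_le_integral_abs_gaussianReal : 1 / 3 ≤ ∫ x, |x| ∂(gaussianReal 0 1) := by
  have hc : ∫ x, Real.cos x ∂(gaussianReal 0 1) = Real.exp (-1 / 2) := by
    have h := charFun_gaussianReal (μ := 0) (v := 1) 1
    rw [charFun_apply_real] at h
    have hre : ∀ x : ℝ, Real.cos x = RCLike.re (Complex.exp ((1 : ℝ) * x * Complex.I)) := fun x => by
      simp [Complex.exp_ofReal_mul_I_re]
    have he : (((1 : ℝ) : ℂ) * ((0 : ℝ) : ℂ) * Complex.I - ((1 : NNReal) : ℝ) * ((1 : ℝ) : ℂ) ^ 2 / 2)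
        = ((-1 / 2 : ℝ) : ℂ) := by
      push_cast; ring
    simp_rw [hre]
    rw [integral_re, h, he, ← Complex.ofReal_exp]
    · rfl
    · refine Integrable.of_bound (by fun_prop) 1 (ae_of_all _ fun x => ?_)
      rw [← Complex.ofReal_mul, Complex.norm_exp_ofReal_mul_I]
  have hi : Integrable (fun x : ℝ => Real.cos x) (gaussianReal 0 1) :=
    Integrable.of_bound (by fun_prop) 1 (ae_of_all _ fun x => by simpa using Real.abs_cos_le_one x)
  have h1 : Real.exp (-1 / 2) ≤ 2 / 3 := by
    rw [show (-1 / 2 : ℝ) = -(1 / 2) by ring, Real.exp_neg, inv_le_comm₀ (Real.exp_pos _) (by norm_num)]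
    linarith [Real.add_one_le_exp (1 / 2 : ℝ)]
  have h2 : ∫ x, (1 - Real.cos x) ∂(gaussianReal 0 1) ≤ ∫ x, |x| ∂(gaussianReal 0 1) := by
    refine integral_mono ((integrable_const _).sub hi)
      ((memLp_id_gaussianReal 1).integrable le_rfl).abs fun x => ?_
    rcases le_total |x| 2 with h | h
    · have := Real.one_sub_sq_div_two_le_cos (x := x)
      have hx : x ^ 2 = |x| ^ 2 := (sq_abs x).symm
      change 1 - Real.cos x ≤ |x|
      nlinarith [abs_nonneg x]
    · change 1 - Real.cos x ≤ |x|
      linarith [Real.neg_one_le_cos x]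
  rw [integral_sub (integrable_const _) hi, hc] at h2
  simp at h2
  linarith

lemma sqrt_sum_sq_le_integral_abs (u : ι → ℝ) :
    √(∑ k, u k ^ 2) ≤ 3 * ∫ g, |∑ k, g k * u k| ∂(stdNormal ι) := by
  set σ := √(∑ k, u k ^ 2) with hσ
  rcases (Real.sqrt_nonneg (∑ k, u k ^ 2)).eq_or_lt with h0 | h0
  · rw [hσ, ← h0]
    have : 0 ≤ ∫ g, |∑ k, g k * u k| ∂(stdNormal ι) := integral_nonneg fun g => abs_nonneg _
    positivity
  rw [← hσ] at h0
  have hsum : ∑ k, (u k / σ) ^ 2 = 1 := by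
    simp_rw [div_pow]
    rw [← Finset.sum_div, hσ, Real.sq_sqrt (Finset.sum_nonneg fun k _ => sq_nonneg _), div_self]
    exact fun h => by simp [hσ, h] at h0
  have hmap : ∫ g, |∑ k, g k * (u k / σ)| ∂(stdNormal ι) = ∫ x, |x| ∂(gaussianReal 0 1) := by
    have := map_sum_mul_stdNormal fun k => u k / σ
    rw [hsum, Real.toNNReal_one] at this
    rw [← this, integral_map (Measurable.aemeasurable (by fun_prop)) (by fun_prop)]
  have hscale : ∀ g : ι → ℝ, |∑ k, g k * u k| = σ * |∑ k, g k * (u k / σ)| := fun g => by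
    rw [← abs_of_pos h0, ← abs_mul, abs_of_pos h0, Finset.mul_sum]
    congr 1
    exact Finset.sum_congr rfl fun k _ => by field_simp
  simp_rw [hscale]
  rw [integral_const_mul, hmap]
  nlinarith [one_third_le_integral_abs_gaussianReal]

lemma integral_neg_stdNormal (f : (ι → ℝ) → ℝ) :
    ∫ g, f (-g) ∂(stdNormal ι) = ∫ g, f g ∂(stdNormal ι) := by
  have h : MeasurePreserving (fun g : ι → ℝ => -g) (stdNormal ι) (stdNormal ι) :=
    measurePreserving_pi (fun _ : ι => gaussianReal 0 1) (fun _ => gaussianReal 0 1)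
      (f := fun _ x => -x) fun _ => ⟨measurable_neg, by rw [gaussianReal_map_neg, neg_zero]⟩
  exact h.integral_comp (MeasurableEquiv.neg (ι → ℝ)).measurableEmbedding f

lemma measurePreserving_uncurry_stdNormal {N κ J : Type*} [Fintype N] [Fintype κ] [Fintype J]
    (e : J ≃ N × κ) :
    MeasurePreserving (fun (g : N → κ → ℝ) j => g (e j).1 (e j).2)
      (Measure.pi fun _ => stdNormal κ) (stdNormal J) := by
  refine ⟨by fun_prop, (Measure.pi_eq fun s hs => ?_).symm⟩
  rw [Measure.map_apply (by fun_prop) (MeasurableSet.univ_pi hs)]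
  have : (fun (g : N → κ → ℝ) j => g (e j).1 (e j).2) ⁻¹' Set.univ.pi s
      = Set.univ.pi fun t => Set.univ.pi fun k => s (e.symm (t, k)) := by
    ext g
    simp only [Set.mem_preimage, Set.mem_univ_pi]
    exact ⟨fun h t k => by simpa using h (e.symm (t, k)), fun h j => by simpa using h (e j).1 (e j).2⟩
  rw [this, Measure.pi_pi]
  simp_rw [Measure.pi_pi]
  rw [← Fintype.prod_prod_type', ← e.symm.prod_comp]

lemma integral_uncurry_stdNormal {N κ J : Type*} [Fintype N] [Fintype κ] [Fintype J]
    (e : J ≃ N × κ) {f : (J → ℝ) → ℝ} (hf : Measurable f) :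
    ∫ g : N → κ → ℝ, f (fun j => g (e j).1 (e j).2) ∂(Measure.pi fun _ => stdNormal κ)
      = ∫ g, f g ∂(stdNormal J) := by
  rw [← (measurePreserving_uncurry_stdNormal e).map_eq,
    integral_map (Measurable.aemeasurable (by fun_prop)) hf.aestronglyMeasurable]

end Gaussian

section Contraction

/-- The sign attached to a boolean. -/
def sgn (b : Bool) : ℝ := if b then 1 else -1

lemma abs_sgn (b : Bool) : |sgn b| = 1 := by cases b <;> simp [sgn]

/-- The average of a function over all choices of `N` signs. -/
def signAverage (N : ℕ) (F : (Fin N → Bool) → ℝ) : ℝ := (2 ^ N : ℝ)⁻¹ * ∑ e, F e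

/-- The Rademacher average of a family of vectors. -/
def rademacherAverage {I : Type*} {N : ℕ} (a : I → Fin N → ℝ) : ℝ :=
  signAverage N fun e => ⨆ i, ∑ t, sgn (e t) * a i t

lemma signAverage_mono {N : ℕ} {F G : (Fin N → Bool) → ℝ} (h : ∀ e, F e ≤ G e) :
    signAverage N F ≤ signAverage N G :=
  mul_le_mul_of_nonneg_left (Finset.sum_le_sum fun e _ => h e) (by positivity)

lemma signAverage_const (N : ℕ) (c : ℝ) : signAverage N (fun _ => c) = c := by
  simp [signAverage]

lemma signAverage_add {N : ℕ} (F G : (Fin N → Bool) → ℝ) :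
    signAverage N (fun e => F e + G e) = signAverage N F + signAverage N G := by
  simp [signAverage, Finset.sum_add_distrib, mul_add]

lemma signAverage_neg {N : ℕ} (F : (Fin N → Bool) → ℝ) :
    signAverage N (fun e => F (fun t => !e t)) = signAverage N F := by
  unfold signAverage
  congr 1
  exact Equiv.sum_comp (Function.Involutive.toPerm (fun (e : Fin N → Bool) t => !e t)
    fun e => by simp) F

lemma signAverage_succ (N : ℕ) (F : (Fin (N + 1) → Bool) → ℝ) :
    signAverage (N + 1) F = (signAverage N (fun e => F (Fin.cons true e))
      + signAverage N (fun e => F (Fin.cons false e))) / 2 := by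
  unfold signAverage
  rw [← (Fin.consEquiv fun _ => Bool).sum_comp, Fintype.sum_prod_type]
  simp [Fin.consEquiv, pow_succ]
  ring

lemma ciSup_add_ciSup_le_of_forall {I : Type*} [Nonempty I] {f g : I → ℝ} {C : ℝ} (h : ∀ i j, f i + g j ≤ C) :
    (⨆ i, f i) + ⨆ i, g i ≤ C := by
  have h1 : ∀ j, (⨆ i, f i) ≤ C - g j := fun j => ciSup_le fun i => by linarith [h i j]
  have h2 : (⨆ j, g j) ≤ C - ⨆ i, f i := ciSup_le fun j => by linarith [h1 j]
  linarith

variable {I κ : Type*} [Countable I] [Nonempty I] [Fintype κ]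

lemma abs_sum_mul_le {κ : Type*} [Fintype κ] (g w : κ → ℝ) {C : ℝ} (hw : ∀ k, |w k| ≤ C) :
    |∑ k, g k * w k| ≤ ∑ k, |g k| * C := by
  refine (Finset.abs_sum_le_sum_abs _ _).trans (Finset.sum_le_sum fun k _ => ?_)
  rw [abs_mul]
  exact mul_le_mul_of_nonneg_left (hw k) (abs_nonneg _)

lemma integrable_iSup_gaussian {B : I → ℝ} {w : I → κ → ℝ} {C : ℝ} (hB : ∀ i, |B i| ≤ C)
    (hw : ∀ i k, |w i k| ≤ C) :
    Integrable (fun g : κ → ℝ => ⨆ i, (B i + ∑ k, g k * w i k)) (stdNormal κ) := by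
  refine integrable_iSup (G := fun g => C + ∑ k, |g k| * C) (fun i => by fun_prop) ?_ fun i g => ?_
  · exact (integrable_const _).add (integrable_finsetSum _ fun k _ =>
      (integrable_eval_stdNormal k).abs.mul_const _)
  · exact (abs_add_le _ _).trans (add_le_add (hB i) (abs_sum_mul_le _ _ (hw i)))

/-- One step of the vector contraction inequality: a random sign in front of `a` is replaced by
Gaussian variables in front of the coordinates of `w`. -/
lemma iSup_add_iSup_sub_le {B a : I → ℝ} {w : I → κ → ℝ} {C : ℝ} (hB : ∀ i, |B i| ≤ C)
    (hw : ∀ i k, |w i k| ≤ C)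
    (hL : ∀ i j, a i - a j ≤ ∫ g, |∑ k, g k * (w i k - w j k)| ∂(stdNormal κ)) :
    ((⨆ i, (B i + a i)) + ⨆ i, (B i - a i)) / 2
      ≤ ∫ g, (⨆ i, (B i + ∑ k, g k * w i k)) ∂(stdNormal κ) := by
  set S : (κ → ℝ) → ℝ := fun g => ⨆ i, (B i + ∑ k, g k * w i k) with hS
  have hSi : Integrable S (stdNormal κ) := integrable_iSup_gaussian hB hw
  have hSi' : Integrable (fun g => S (-g)) (stdNormal κ) := by
    have : ∀ g, S (-g) = ⨆ i, (B i + ∑ k, g k * (-w i k)) := fun g => by simp [hS]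
    simp_rw [this]
    exact integrable_iSup_gaussian hB fun i k => by simpa using hw i k
  have hle : ∀ g i, B i + ∑ k, g k * w i k ≤ S g := fun g i =>
    le_ciSup (f := fun i => B i + ∑ k, g k * w i k) (bddAbove_range_of_abs_le fun i =>
      (abs_add_le _ _).trans (add_le_add (hB i) (abs_sum_mul_le g (w i) (hw i)))) i
  have key : ∀ i j, (B i + a i) + (B j - a j) ≤ 2 * ∫ g, S g ∂(stdNormal κ) := fun i j => by
    have h1 : B i + B j + ∫ g, |∑ k, g k * (w i k - w j k)| ∂(stdNormal κ)
        ≤ ∫ g, (S g + S (-g)) ∂(stdNormal κ) := by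
      have h0 := integrable_abs_sum_mul_stdNormal fun k => w i k - w j k
      calc _ = ∫ g, (B i + B j + |∑ k, g k * (w i k - w j k)|) ∂(stdNormal κ) := by
            rw [integral_add (integrable_const _) h0]; simp
        _ ≤ _ := by
            refine integral_mono ((integrable_const _).add h0) (hSi.add hSi') fun g => ?_
            have e1 := hle g i
            have e2 := hle g j
            have e3 := hle (-g) i
            have e4 := hle (-g) j
            simp only [Pi.neg_apply, neg_mul, Finset.sum_neg_distrib] at e3 e4
            simp only [mul_sub, Finset.sum_sub_distrib]
            rcases abs_cases ((∑ k, g k * w i k) - ∑ k, g k * w j k) with ⟨h, _⟩ | ⟨h, _⟩ <;>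
              rw [h] <;> linarith
    rw [integral_add hSi hSi', integral_neg_stdNormal] at h1
    linarith [hL i j]
  linarith [ciSup_add_ciSup_le_of_forall key]

lemma integrable_iSup_gaussian_pi {N : ℕ} {B : I → ℝ} {w : I → Fin N → κ → ℝ} {C : ℝ}
    (hB : ∀ i, |B i| ≤ C) (hw : ∀ i t k, |w i t k| ≤ C) :
    Integrable (fun g : Fin N → κ → ℝ => ⨆ i, (B i + ∑ t, ∑ k, g t k * w i t k))
      (Measure.pi fun _ => stdNormal κ) := by
  refine integrable_iSup (G := fun g => C + ∑ t, ∑ k, |g t k| * C) (fun i => by fun_prop) ?_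
    fun i g => ?_
  · refine (integrable_const _).add (integrable_finsetSum _ fun t _ =>
      integrable_finsetSum _ fun k _ => Integrable.mul_const ?_ _)
    exact integrable_comp_eval (μ := fun _ : Fin N => stdNormal κ) (f := fun h : κ → ℝ => |h k|)
      (integrable_eval_stdNormal k).abs
  · refine (abs_add_le _ _).trans (add_le_add (hB i) ?_)
    refine (Finset.abs_sum_le_sum_abs _ _).trans (Finset.sum_le_sum fun t _ => ?_)
    exact abs_sum_mul_le _ _ (hw i t)

lemma signAverage_iSup_le_gaussian (N : ℕ) (B : I → ℝ) (a : I → Fin N → ℝ)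
    (w : I → Fin N → κ → ℝ) {C : ℝ} (hB : ∃ C, ∀ i, |B i| ≤ C) (ha : ∀ i t, |a i t| ≤ C)
    (hw : ∀ i t k, |w i t k| ≤ C)
    (hL : ∀ i j t, a i t - a j t ≤ ∫ g, |∑ k, g k * (w i t k - w j t k)| ∂(stdNormal κ)) :
    signAverage N (fun e => ⨆ i, (B i + ∑ t, sgn (e t) * a i t))
      ≤ ∫ g : Fin N → κ → ℝ, (⨆ i, (B i + ∑ t, ∑ k, g t k * w i t k))
          ∂(Measure.pi fun _ => stdNormal κ) := by
  induction N generalizing B with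
  | zero => simp [signAverage]
  | succ N ih =>
    obtain ⟨D, hD⟩ := hB
    have hs : ∀ b, signAverage N (fun e => ⨆ i, (B i + ∑ t, sgn ((Fin.cons b e : Fin (N + 1) → Bool) t) * a i t))
        ≤ ∫ g : Fin N → κ → ℝ, (⨆ i, ((B i + sgn b * a i 0) + ∑ t, ∑ k, g t k * w i t.succ k))
          ∂(Measure.pi fun _ => stdNormal κ) := fun b => by
      have := ih (fun i => B i + sgn b * a i 0) (fun i t => a i t.succ) (fun i t => w i t.succ)
        ⟨D + C, fun i => (abs_add_le _ _).trans (add_le_add (hD i) (by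
          rw [abs_mul, abs_sgn, one_mul]; exact ha i 0))⟩
        (fun i t => ha _ _) (fun i t k => hw _ _ _) (fun i j t => hL i j _)
      simpa [Fin.sum_univ_succ, add_assoc] using this
    have hB' : ∀ b i, |B i + sgn b * a i 0| ≤ max (D + C) C := fun b i =>
      ((abs_add_le _ _).trans (add_le_add (hD i) (by
        rw [abs_mul, abs_sgn, one_mul]; exact ha i 0))).trans (le_max_left _ _)
    have hint : ∀ b, Integrable (fun g : Fin N → κ → ℝ =>
        ⨆ i, ((B i + sgn b * a i 0) + ∑ t, ∑ k, g t k * w i t.succ k))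
        (Measure.pi fun _ => stdNormal κ) := fun b =>
      integrable_iSup_gaussian_pi (hB' b) fun i t k => (hw i t.succ k).trans (le_max_right _ _)
    have hfull : Integrable (fun g : Fin (N + 1) → κ → ℝ => ⨆ i, (B i + ∑ t, ∑ k, g t k * w i t k))
        (Measure.pi fun _ => stdNormal κ) :=
      integrable_iSup_gaussian_pi (C := max D C) (fun i => (hD i).trans (le_max_left _ _))
        fun i t k => (hw i t k).trans (le_max_right _ _)
    rw [signAverage_succ, integral_pi_succ_symm (stdNormal κ) hfull]
    calc _ ≤ ((∫ g : Fin N → κ → ℝ, (⨆ i, ((B i + sgn true * a i 0) + ∑ t, ∑ k, g t k * w i t.succ k))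
          ∂(Measure.pi fun _ => stdNormal κ)) + (∫ g : Fin N → κ → ℝ, (⨆ i, ((B i + sgn false * a i 0)
            + ∑ t, ∑ k, g t k * w i t.succ k)) ∂(Measure.pi fun _ => stdNormal κ))) / 2 := by
          linarith [hs true, hs false]
      _ = ∫ g : Fin N → κ → ℝ, ((⨆ i, ((B i + sgn true * a i 0) + ∑ t, ∑ k, g t k * w i t.succ k))
          + (⨆ i, ((B i + sgn false * a i 0) + ∑ t, ∑ k, g t k * w i t.succ k))) / 2
            ∂(Measure.pi fun _ => stdNormal κ) := by
          rw [integral_div, integral_add (hint true) (hint false)]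
      _ ≤ _ := by
          refine integral_mono (((hint true).add (hint false)).div_const 2)
            ((integrable_cons_iff (stdNormal κ)).2 hfull).integral_prod_right fun g => ?_
          have h := iSup_add_iSup_sub_le (B := fun i => B i + ∑ t, ∑ k, g t k * w i t.succ k)
            (a := fun i => a i 0) (w := fun i => w i 0)
            (C := max (D + ∑ t, ∑ k, |g t k| * C) C) (fun i => ?_)
            (fun i k => (hw i 0 k).trans (le_max_right _ _)) (fun i j => hL i j 0)
          · simp only [Fin.sum_univ_succ, Fin.cons_zero, Fin.cons_succ, sgn]
            simp only [if_true, one_mul, Bool.false_eq_true, if_false, neg_mul]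
            refine le_trans (le_of_eq ?_) (h.trans (le_of_eq ?_))
            · congr 2 <;> (congr 1; funext i; ring)
            · congr 1; funext g₀; congr 1; funext i; ring
          · refine le_trans ((abs_add_le _ _).trans (add_le_add (hD i) ?_)) (le_max_left _ _)
            refine (Finset.abs_sum_le_sum_abs _ _).trans (Finset.sum_le_sum fun t _ => ?_)
            exact abs_sum_mul_le _ _ (hw i t.succ)

/-- Vector contraction: the Rademacher average of a Lipschitz image of a class of vectors is
bounded by the Gaussian average of the class. -/
theorem rademacherAverage_le_gaussian {N : ℕ} {J : Type*} [Fintype J] (e : J ≃ Fin N × κ)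
    (a : I → Fin N → ℝ) (w : I → J → ℝ) {C L : ℝ} (hL0 : 0 ≤ L) (ha : ∀ i t, |a i t| ≤ C)
    (hw : ∀ i j, |w i j| ≤ C)
    (hL : ∀ i j t, a i t - a j t
      ≤ L * √(∑ k, (w i (e.symm (t, k)) - w j (e.symm (t, k))) ^ 2)) :
    rademacherAverage a ≤ 3 * L * ∫ g : J → ℝ, (⨆ i, ∑ j, g j * w i j) ∂(stdNormal J) := by
  have h := signAverage_iSup_le_gaussian N (fun _ : I => 0) a
    (fun i t k => 3 * L * w i (e.symm (t, k))) (C := max C (3 * L * C)) ⟨0, by simp⟩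
    (fun i t => (ha i t).trans (le_max_left _ _))
    (fun i t k => by
      rw [abs_mul, abs_of_nonneg (by positivity : 0 ≤ 3 * L)]
      exact (mul_le_mul_of_nonneg_left (hw _ _) (by positivity)).trans (le_max_right _ _))
    (fun i j t => by
      refine (hL i j t).trans ?_
      have h1 := sqrt_sum_sq_le_integral_abs fun k => w i (e.symm (t, k)) - w j (e.symm (t, k))
      refine (mul_le_mul_of_nonneg_left h1 hL0).trans (le_of_eq ?_)
      rw [← mul_assoc, mul_comm L 3, ← integral_const_mul]
      congr 1
      funext g
      rw [← abs_of_nonneg (by positivity : 0 ≤ 3 * L), ← abs_mul,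
        abs_of_nonneg (by positivity : 0 ≤ 3 * L), Finset.mul_sum]
      congr 1
      exact Finset.sum_congr rfl fun k _ => by ring)
  simp only [zero_add] at h
  refine h.trans (le_of_eq ?_)
  rw [← integral_const_mul, ← integral_uncurry_stdNormal e]
  · congr 1
    funext g
    rw [Real.mul_iSup_of_nonneg (by positivity)]
    congr 1
    funext i
    rw [← e.symm.sum_comp, Fintype.sum_prod_type, Finset.mul_sum]
    refine Finset.sum_congr rfl fun t _ => ?_
    rw [Finset.mul_sum]
    exact Finset.sum_congr rfl fun k _ => by simp; ring
  · exact (Measurable.iSup fun i => by fun_prop).const_mul _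

end Contraction

section Symmetrization

variable {Z : Type*} [MeasurableSpace Z]

lemma abs_le_one_of_mem {I Y : Type*} {f : I → Y → ℝ} (hf0 : ∀ i y, 0 ≤ f i y) (hf1 : ∀ i y, f i y ≤ 1) (i : I) (y : Y) :
    |f i y| ≤ 1 := abs_le.2 ⟨by linarith [hf0 i y], hf1 i y⟩

lemma measurePreserving_swap_coordinates (P : Measure Z) [IsProbabilityMeasure P] {N : ℕ}
    (e : Fin N → Bool) :
    MeasurePreserving (fun p : (Fin N → Z) × (Fin N → Z) =>
        ((fun t => if e t then p.1 t else p.2 t, fun t => if e t then p.2 t else p.1 t) :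
          (Fin N → Z) × (Fin N → Z)))
      ((Measure.pi fun _ => P).prod (Measure.pi fun _ => P))
      ((Measure.pi fun _ => P).prod (Measure.pi fun _ => P)) := by
  have h1 := measurePreserving_arrowProdEquivProdArrow Z Z (Fin N) (fun _ => P) fun _ => P
  have h2 : MeasurePreserving (fun (q : Fin N → Z × Z) t => if e t then q t else (q t).swap)
      (Measure.pi fun _ => P.prod P) (Measure.pi fun _ => P.prod P) := by
    refine measurePreserving_pi (fun _ : Fin N => P.prod P) (fun _ => P.prod P)
      (f := fun t q => if e t then q else q.swap) fun t => ?_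
    cases h : e t
    · simpa using Measure.measurePreserving_swap (μ := P) (ν := P)
    · simp only [if_true]
      exact MeasurePreserving.id (P.prod P)
  convert (h1.comp h2).comp h1.symm using 1
  funext p
  ext t <;> cases h : e t <;>
    simp [h, MeasurableEquiv.arrowProdEquivProdArrow, Equiv.arrowProdEquivProdArrow]

variable {I : Type*}

/-- The largest deviation, over a class of functions, of the sample sum from its mean. -/
def deviation (P : Measure Z) (f : I → Z → ℝ) {N : ℕ} (z : Fin N → Z) : ℝ :=
  ⨆ i, (N * ∫ y, f i y ∂P - ∑ t, f i (z t))

lemma measurable_deviation [Countable I] {P : Measure Z} {f : I → Z → ℝ} {N : ℕ}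
    (hf : ∀ i, Measurable (f i)) :
    Measurable fun z : Fin N → Z => deviation P f z :=
  Measurable.iSup fun i => by have := hf i; fun_prop

lemma measurable_rademacherAverage [Countable I] {f : I → Z → ℝ} {N : ℕ}
    (hf : ∀ i, Measurable (f i)) :
    Measurable fun z : Fin N → Z => rademacherAverage fun i t => f i (z t) := by
  unfold rademacherAverage signAverage
  refine (Finset.measurable_sum _ fun e _ => Measurable.iSup fun i => ?_).const_mul _
  have := hf i
  fun_prop

variable {P : Measure Z} [IsProbabilityMeasure P] {f : I → Z → ℝ} {N : ℕ}

lemma abs_sgn_sum_le (e : Fin N → Bool) {x : Fin N → ℝ} {B : ℝ} (hx : ∀ t, |x t| ≤ B) :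
    |∑ t, sgn (e t) * x t| ≤ N * B := by
  refine (Finset.abs_sum_le_sum_abs _ _).trans ?_
  calc _ ≤ ∑ t : Fin N, B := Finset.sum_le_sum fun t _ => by rw [abs_mul, abs_sgn, one_mul]; exact hx t
    _ = N * B := by simp

lemma abs_mean_sub_sum_le (hf0 : ∀ i y, 0 ≤ f i y) (hf1 : ∀ i y, f i y ≤ 1) (i : I)
    (z : Fin N → Z) : |N * ∫ y, f i y ∂P - ∑ t, f i (z t)| ≤ N := by
  have h0 : 0 ≤ ∫ y, f i y ∂P := integral_nonneg (hf0 i)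
  have h1 : ∫ y, f i y ∂P ≤ 1 := by
    refine (integral_mono_of_nonneg (ae_of_all _ (hf0 i)) (integrable_const 1)
      (ae_of_all _ (hf1 i))).trans (by simp)
  have h2 : 0 ≤ ∑ t, f i (z t) := Finset.sum_nonneg fun t _ => hf0 _ _
  have h3 : ∑ t, f i (z t) ≤ N := by
    simpa using Finset.sum_le_sum (s := Finset.univ) fun t _ => hf1 i (z t)
  have hN : (0 : ℝ) ≤ N := N.cast_nonneg
  rw [abs_le]
  constructor <;> nlinarith

lemma le_deviation (hf0 : ∀ i y, 0 ≤ f i y) (hf1 : ∀ i y, f i y ≤ 1) (i : I) (z : Fin N → Z) :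
    N * ∫ y, f i y ∂P - ∑ t, f i (z t) ≤ deviation P f z :=
  le_ciSup (f := fun i => N * ∫ y, f i y ∂P - ∑ t, f i (z t))
    (bddAbove_range_of_abs_le fun i => abs_mean_sub_sum_le hf0 hf1 i z) i

variable [Nonempty I]

lemma abs_deviation_le (hf0 : ∀ i y, 0 ≤ f i y) (hf1 : ∀ i y, f i y ≤ 1) (z : Fin N → Z) :
    |deviation P f z| ≤ N := abs_ciSup_le fun i => abs_mean_sub_sum_le hf0 hf1 i z

lemma signAverage_abs_le {F : (Fin N → Bool) → ℝ} {B : ℝ} (h : ∀ e, |F e| ≤ B) :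
    |signAverage N F| ≤ B := by
  rw [abs_le]
  constructor
  · rw [← signAverage_const N (-B)]
    exact signAverage_mono fun e => (abs_le.1 (h e)).1
  · rw [← signAverage_const N B]
    exact signAverage_mono fun e => (abs_le.1 (h e)).2

lemma abs_rademacherAverage_le {a : I → Fin N → ℝ} (h : ∀ i t, |a i t| ≤ 1) :
    |rademacherAverage a| ≤ N :=
  signAverage_abs_le fun e => abs_ciSup_le fun i => by simpa using abs_sgn_sum_le e (h i)

lemma ciSup_sub_ciSup_le {x y : I → ℝ} {c : ℝ} (hy : BddAbove (Set.range y))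
    (h : ∀ i, x i - y i ≤ c) : (⨆ i, x i) - ⨆ i, y i ≤ c := by
  have : (⨆ i, x i) ≤ c + ⨆ i, y i := ciSup_le fun i => by linarith [h i, le_ciSup hy i]
  linarith

lemma deviation_sub_le (hf0 : ∀ i y, 0 ≤ f i y) (hf1 : ∀ i y, f i y ≤ 1) {z z' : Fin N → Z}
    {t : Fin N} (h : ∀ s, s ≠ t → z s = z' s) : deviation P f z - deviation P f z' ≤ 1 := by
  refine ciSup_sub_ciSup_le (bddAbove_range_of_abs_le fun i => abs_mean_sub_sum_le hf0 hf1 i z')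
    fun i => ?_
  have : ∑ s, f i (z' s) - ∑ s, f i (z s) = f i (z' t) - f i (z t) := by
    rw [← Finset.sum_sub_distrib]
    refine Finset.sum_eq_single t (fun s _ hs => by rw [h s hs, sub_self]) (by simp)
  linarith [hf0 i (z t), hf1 i (z' t)]

lemma rademacherAverage_sub_le {Y : Type*} {f : I → Y → ℝ}
    (hf0 : ∀ i y, 0 ≤ f i y) (hf1 : ∀ i y, f i y ≤ 1) {z z' : Fin N → Y} {t : Fin N} (h : ∀ s, s ≠ t → z s = z' s) :
    rademacherAverage (fun i s => f i (z s)) - rademacherAverage (fun i s => f i (z' s)) ≤ 1 := by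
  have hb := abs_le_one_of_mem hf0 hf1
  have : rademacherAverage (fun i s => f i (z s))
      ≤ signAverage N (fun e => (⨆ i, ∑ s, sgn (e s) * f i (z' s)) + 1) := by
    refine signAverage_mono fun e => ?_
    have := ciSup_sub_ciSup_le (x := fun i => ∑ s, sgn (e s) * f i (z s))
      (y := fun i => ∑ s, sgn (e s) * f i (z' s)) (c := 1)
      (bddAbove_range_of_abs_le fun i => abs_sgn_sum_le e fun t => hb i _) fun i => by
        have : ∑ s, sgn (e s) * f i (z s) - ∑ s, sgn (e s) * f i (z' s)
            = sgn (e t) * (f i (z t) - f i (z' t)) := by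
          rw [← Finset.sum_sub_distrib]
          refine (Finset.sum_eq_single t (fun s _ hs => by rw [h s hs, sub_self]) (by simp)).trans ?_
          ring
        rw [this]
        refine (le_abs_self _).trans ?_
        rw [abs_mul, abs_sgn, one_mul, abs_le]
        constructor <;> linarith [hf0 i (z t), hf1 i (z' t), hf0 i (z' t), hf1 i (z t)]
    linarith
  rw [signAverage_add, signAverage_const] at this
  unfold rademacherAverage at this ⊢
  linarith

variable [Countable I]

/-- Symmetrization. -/
theorem integral_deviation_le (hf : ∀ i, Measurable (f i)) (hf0 : ∀ i y, 0 ≤ f i y)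
    (hf1 : ∀ i y, f i y ≤ 1) :
    ∫ z : Fin N → Z, deviation P f z ∂(Measure.pi fun _ => P)
      ≤ 2 * ∫ z : Fin N → Z, rademacherAverage (fun i t => f i (z t)) ∂(Measure.pi fun _ => P) := by
  set Q : Measure (Fin N → Z) := Measure.pi fun _ => P with hQ
  have hb := abs_le_one_of_mem hf0 hf1
  have hfi : ∀ i, Integrable (f i) P := fun i => integrable_of_abs_le (hf i) (hb i)
  set G : (Fin N → Bool) → (Fin N → Z) × (Fin N → Z) → ℝ := fun e p =>
    ⨆ i, ∑ t, sgn (e t) * (f i (p.2 t) - f i (p.1 t)) with hG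
  have hterm : ∀ (e : Fin N → Bool) (p : (Fin N → Z) × (Fin N → Z)) i, |∑ t, sgn (e t) * (f i (p.2 t) - f i (p.1 t))| ≤ N * 2 := fun e p i =>
    abs_sgn_sum_le e fun t => by
      have h1 := abs_le.1 (hb i (p.2 t)); have h2 := abs_le.1 (hb i (p.1 t))
      rw [abs_le]; constructor <;> linarith
  have hGm : ∀ e, Measurable (G e) := fun e => Measurable.iSup fun i => by
    have := hf i
    fun_prop
  have hGb : ∀ e p, |G e p| ≤ N * 2 := fun e p => abs_ciSup_le (hterm e p)
  have hGi : ∀ e, Integrable (G e) (Q.prod Q) := fun e => integrable_of_abs_le (hGm e) (hGb e)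
  have hswap : ∀ e, ∫ p, G e p ∂(Q.prod Q) = ∫ p, G (fun _ => true) p ∂(Q.prod Q) := fun e => by
    have h := measurePreserving_swap_coordinates P e
    conv_rhs => rw [← h.map_eq]
    rw [integral_map h.measurable.aemeasurable (hGm _).aestronglyMeasurable]
    congr 1
    funext p
    simp only [hG]
    congr 1
    funext i
    refine Finset.sum_congr rfl fun t _ => ?_
    cases e t <;> simp [sgn]
  have h1 : ∫ z, deviation P f z ∂Q ≤ ∫ p, G (fun _ => true) p ∂(Q.prod Q) := by
    rw [integral_prod _ (hGi _)]
    refine integral_mono (integrable_of_abs_le (measurable_deviation hf) (abs_deviation_le hf0 hf1))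
      (hGi _).integral_prod_left fun z => ciSup_le fun i => ?_
    have hGz : Measurable fun w => G (fun _ => true) (z, w) := (hGm _).comp (by fun_prop)
    have hev : ∀ t : Fin N, Integrable (fun w : Fin N → Z => f i (w t)) Q := fun t =>
      integrable_comp_eval (hfi i)
    calc _ = ∫ w : Fin N → Z, ∑ t, (f i (w t) - f i (z t)) ∂Q := by
          simp_rw [Finset.sum_sub_distrib]
          rw [integral_sub (integrable_finsetSum _ fun t _ => hev t) (integrable_const _),
            integral_finsetSum _ fun t _ => hev t]
          have : ∀ t : Fin N, ∫ w : Fin N → Z, f i (w t) ∂Q = ∫ y, f i y ∂P := fun t =>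
            integral_comp_eval (hf i).aestronglyMeasurable
          simp [this]
      _ ≤ _ := by
          refine integral_mono (integrable_finsetSum _ fun t _ => (hev t).sub (integrable_const _))
            (integrable_of_abs_le hGz fun w => hGb _ _) fun w => ?_
          refine le_trans (le_of_eq ?_) (le_ciSup (bddAbove_range_of_abs_le
            (hterm (fun _ => true) (z, w))) i)
          simp [sgn]
  have hR := measurable_rademacherAverage (N := N) hf
  have hRi : Integrable (fun z : Fin N → Z => rademacherAverage fun i t => f i (z t)) Q :=
    integrable_of_abs_le hR fun z => abs_rademacherAverage_le fun i t => hb i _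
  have h2 : ∀ p, signAverage N (fun e => G e p)
      ≤ rademacherAverage (fun i t => f i (p.2 t)) + rademacherAverage (fun i t => f i (p.1 t)) := by
    intro p
    unfold rademacherAverage
    rw [← signAverage_neg (fun e => ⨆ i, ∑ t, sgn (e t) * f i (p.1 t)), ← signAverage_add]
    refine signAverage_mono fun e => ciSup_le fun i => ?_
    have e1 := le_ciSup (f := fun i => ∑ t, sgn (e t) * f i (p.2 t))
      (bddAbove_range_of_abs_le fun i => abs_sgn_sum_le e fun t => hb i _) i
    have e2 := le_ciSup (f := fun i => ∑ t, sgn (!e t) * f i (p.1 t))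
      (bddAbove_range_of_abs_le fun i => abs_sgn_sum_le (fun t => !e t) fun t => hb i _) i
    refine le_trans (le_of_eq ?_) (add_le_add e1 e2)
    rw [← Finset.sum_add_distrib]
    refine Finset.sum_congr rfl fun t _ => ?_
    cases e t <;> simp [sgn] <;> ring
  calc _ ≤ ∫ p, G (fun _ => true) p ∂(Q.prod Q) := h1
    _ = signAverage N fun e => ∫ p, G e p ∂(Q.prod Q) := by
        simp_rw [hswap]; rw [signAverage_const]
    _ = ∫ p, signAverage N (fun e => G e p) ∂(Q.prod Q) := by
        unfold signAverage
        rw [integral_const_mul, integral_finsetSum _ fun e _ => hGi e]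
    _ ≤ ∫ p : (Fin N → Z) × (Fin N → Z), (rademacherAverage (fun i t => f i (p.2 t))
          + rademacherAverage (fun i t => f i (p.1 t))) ∂(Q.prod Q) := by
        refine integral_mono ?_ (hRi.comp_snd Q |>.add (hRi.comp_fst Q)) h2
        exact (integrable_finsetSum _ fun e _ => hGi e).const_mul _
    _ = _ := by
        rw [integral_add (hRi.comp_snd Q) (hRi.comp_fst Q),
          integral_fun_snd (μ := Q) (fun z : Fin N → Z => rademacherAverage fun i t => f i (z t)),
          integral_fun_fst (ν := Q) (fun z : Fin N → Z => rademacherAverage fun i t => f i (z t))]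
        simp
        ring

/-- With high probability all sample sums deviate from their means by at most twice the Rademacher
average of the class on the sample, up to a term of the order of the square root of the size. -/
theorem measure_deviation_ge_le (hN : 0 < N) (hf : ∀ i, Measurable (f i)) (hf0 : ∀ i y, 0 ≤ f i y)
    (hf1 : ∀ i y, f i y ≤ 1) {u : ℝ} (hu : 0 ≤ u) :
    (Measure.pi fun _ => P)
        {z : Fin N → Z | u ≤ deviation P f z - 2 * rademacherAverage fun i t => f i (z t)}
      ≤ ENNReal.ofReal (Real.exp (-2 * u ^ 2 / (N * 3 ^ 2))) := by
  have hb := abs_le_one_of_mem hf0 hf1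
  have hdi : Integrable (fun z : Fin N → Z => deviation P f z) (Measure.pi fun _ => P) :=
    integrable_of_abs_le (measurable_deviation hf) (abs_deviation_le hf0 hf1)
  have hR := measurable_rademacherAverage (N := N) hf
  have hRb : ∀ z : Fin N → Z, |rademacherAverage fun i t => f i (z t)| ≤ N := fun z =>
    abs_rademacherAverage_le fun i t => hb i _
  refine measure_ge_le_of_bounded_differences P (by norm_num) hN
    (fun z => deviation P f z - 2 * rademacherAverage fun i t => f i (z t))
    ((measurable_deviation hf).sub (hR.const_mul 2)) ⟨3 * N, fun z => ?_⟩ (fun z z' t h => ?_) ?_ hu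
  · have h1 := abs_le.1 (abs_deviation_le (P := P) hf0 hf1 z)
    have h2 := abs_le.1 (hRb z)
    rw [abs_le]
    constructor <;> linarith
  · linarith [deviation_sub_le (P := P) hf0 hf1 h,
      rademacherAverage_sub_le hf0 hf1 fun s hs => (h s hs).symm]
  · rw [integral_sub hdi ((integrable_of_abs_le hR hRb).const_mul 2), integral_const_mul]
    linarith [integral_deviation_le (P := P) (N := N) hf hf0 hf1]

end Symmetrization

section LossToError

/-- The error rate `1 - exp (-u)` of a policy of constant logistic loss `u`. -/
def lossToError (u : ℝ) : ℝ := 1 - Real.exp (-u)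

lemma lossToError_nonneg {u : ℝ} (hu : 0 ≤ u) : 0 ≤ lossToError u := by
  have := Real.exp_le_one_iff.2 (neg_nonpos.2 hu)
  unfold lossToError; linarith

lemma lossToError_le_one (u : ℝ) : lossToError u ≤ 1 := by
  have := Real.exp_pos (-u)
  unfold lossToError; linarith

lemma lossToError_mono {u v : ℝ} (h : u ≤ v) : lossToError u ≤ lossToError v := by
  unfold lossToError; gcongr

@[fun_prop]
lemma continuous_lossToError : Continuous lossToError := by unfold lossToError; fun_prop

lemma lossToError_sub_le {u v : ℝ} (hv : 0 ≤ v) : lossToError u - lossToError v ≤ |u - v| := by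
  rcases le_total u v with h | h
  · linarith [lossToError_mono h, abs_nonneg (u - v)]
  · have h1 : Real.exp (-u) = Real.exp (-v) * Real.exp (-(u - v)) := by
      rw [← Real.exp_add]; congr 1; ring
    have h2 := Real.add_one_le_exp (-(u - v))
    have h3 := Real.exp_le_one_iff.2 (neg_nonpos.2 hv)
    have h4 := Real.exp_pos (-v)
    rw [abs_of_nonneg (by linarith)]
    unfold lossToError
    rw [h1]
    nlinarith

/-- Jensen's inequality for `lossToError`. -/
lemma mean_lossToError_le {n : ℕ} (hn : 0 < n) (u : Fin n → ℝ) :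
    (1 / (n : ℝ)) * ∑ j, lossToError (u j) ≤ lossToError ((1 / (n : ℝ)) * ∑ j, u j) := by
  have hn' : (n : ℝ) ≠ 0 := by positivity
  have h := convexOn_exp.map_sum_le (t := Finset.univ) (w := fun _ : Fin n => 1 / (n : ℝ))
    (p := fun j => -u j) (fun _ _ => by positivity) (by simp [hn']) (fun _ _ => Set.mem_univ _)
  simp only [smul_eq_mul, ← Finset.mul_sum, Finset.sum_neg_distrib, mul_neg] at h
  unfold lossToError
  rw [Finset.sum_sub_distrib, mul_sub]
  simp only [Finset.sum_const, Finset.card_univ, Fintype.card_fin, nsmul_eq_mul, mul_one]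
  rw [one_div_mul_cancel hn']
  linarith

end LossToError

section Softmax

variable {A : Type*} [Fintype A]

lemma softmax_nonneg (v : A → ℝ) (a : A) : 0 ≤ softmax v a := by unfold softmax; positivity

lemma sum_exp_pos [Nonempty A] (v : A → ℝ) : 0 < ∑ b, Real.exp (v b) :=
  Finset.sum_pos (fun _ _ => Real.exp_pos _) Finset.univ_nonempty

lemma sum_softmax [Nonempty A] (v : A → ℝ) : ∑ a, softmax v a = 1 := by
  unfold softmax
  rw [← Finset.sum_div, div_self (sum_exp_pos v).ne']

lemma softmax_le_one (v : A → ℝ) (a : A) : softmax v a ≤ 1 := by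
  have : Nonempty A := ⟨a⟩
  rw [← sum_softmax v]
  exact Finset.single_le_sum (fun b _ => softmax_nonneg v b) (Finset.mem_univ a)

lemma softmax_pos (v : A → ℝ) (a : A) : 0 < softmax v a := by
  have : Nonempty A := ⟨a⟩
  exact div_pos (Real.exp_pos _) (sum_exp_pos v)

/-- The logistic loss of the softmax of `v` at `a`. -/
def softmaxLoss (v : A → ℝ) (a : A) : ℝ := -Real.log (softmax v a)

lemma softmaxLoss_nonneg (v : A → ℝ) (a : A) : 0 ≤ softmaxLoss v a :=
  neg_nonneg.2 (Real.log_nonpos (softmax_nonneg v a) (softmax_le_one v a))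

lemma lossToError_softmaxLoss (v : A → ℝ) (a : A) :
    lossToError (softmaxLoss v a) = 1 - softmax v a := by
  rw [lossToError, softmaxLoss, neg_neg, Real.exp_log (softmax_pos v a)]

lemma softmaxLoss_eq (v : A → ℝ) (a : A) :
    softmaxLoss v a = Real.log (∑ b, Real.exp (v b)) - v a := by
  have : Nonempty A := ⟨a⟩
  rw [softmaxLoss, softmax, Real.log_div (Real.exp_pos _).ne' (sum_exp_pos v).ne', Real.log_exp]
  ring

lemma softmaxLoss_sub_le (v v' : A → ℝ) (a : A) :
    softmaxLoss v a - softmaxLoss v' a ≤ 2 * √(∑ b, (v b - v' b) ^ 2) := by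
  have : Nonempty A := ⟨a⟩
  set D := √(∑ b, (v b - v' b) ^ 2)
  have hD : ∀ b, |v b - v' b| ≤ D := fun b => Real.abs_le_sqrt
    (Finset.single_le_sum (f := fun b => (v b - v' b) ^ 2) (fun b _ => sq_nonneg _)
      (Finset.mem_univ b))
  have h1 : Real.log (∑ b, Real.exp (v b)) ≤ D + Real.log (∑ b, Real.exp (v' b)) := by
    rw [← Real.log_exp D, ← Real.log_mul (Real.exp_pos _).ne' (sum_exp_pos v').ne']
    refine Real.log_le_log (sum_exp_pos v) ?_
    rw [Finset.mul_sum]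
    refine Finset.sum_le_sum fun b _ => ?_
    rw [← Real.exp_add]
    gcongr
    linarith [(abs_le.1 (hD b)).2]
  rw [softmaxLoss_eq, softmaxLoss_eq]
  linarith [(abs_le.1 (hD a)).1]

lemma continuous_softmaxLoss (a : A) : Continuous fun v : A → ℝ => softmaxLoss v a := by
  have : Nonempty A := ⟨a⟩
  simp_rw [softmaxLoss_eq]
  exact (Continuous.log (by fun_prop) fun v => (sum_exp_pos v).ne').sub (by fun_prop)

end Softmax

section CloningLoss

variable {A : Type*} [Fintype A] {d n : ℕ}

/-- The weight matrices of Frobenius norm at most one. -/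
def weightBall (A : Type*) [Fintype A] (d : ℕ) : Set (Matrix A (Fin d) ℝ) :=
  {W | √(∑ a, ∑ i, W a i ^ 2) ≤ 1}

instance : Nonempty (weightBall A d) := ⟨0, by simp [weightBall]⟩

lemma sqrt_sum_sq_mulVec_le {W : Matrix A (Fin d) ℝ} (hW : W ∈ weightBall A d) (u : Fin d → ℝ) :
    √(∑ a, (W *ᵥ u) a ^ 2) ≤ √(∑ i, u i ^ 2) := by
  refine Real.sqrt_le_sqrt ?_
  have hW' : ∑ a, ∑ i, W a i ^ 2 ≤ 1 := by
    simpa [weightBall, Real.sqrt_le_one] using hW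
  calc ∑ a, (W *ᵥ u) a ^ 2 ≤ ∑ a, (∑ i, W a i ^ 2) * ∑ i, u i ^ 2 :=
        Finset.sum_le_sum fun a _ => Finset.sum_mul_sq_le_sq_mul_sq Finset.univ (W a) u
    _ = (∑ a, ∑ i, W a i ^ 2) * ∑ i, u i ^ 2 := by rw [Finset.sum_mul]
    _ ≤ _ := mul_le_of_le_one_left (Finset.sum_nonneg fun i _ => sq_nonneg _) hW'

/-- The empirical logistic loss of the weights `W` on features `v` labelled with actions `a`. -/
def cloningLoss (a : Fin n → A) (v : Fin n → Fin d → ℝ) (W : Matrix A (Fin d) ℝ) : ℝ :=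
  (1 / (n : ℝ)) * ∑ j, softmaxLoss (W *ᵥ v j) (a j)

/-- The smallest empirical logistic loss of weights of Frobenius norm at most one. -/
def minCloningLoss (a : Fin n → A) (v : Fin n → Fin d → ℝ) : ℝ :=
  ⨅ W : weightBall A d, cloningLoss a v W

lemma cloningLoss_nonneg (a : Fin n → A) (v : Fin n → Fin d → ℝ) (W : Matrix A (Fin d) ℝ) :
    0 ≤ cloningLoss a v W :=
  mul_nonneg (by positivity) (Finset.sum_nonneg fun j _ => softmaxLoss_nonneg _ _)

lemma minCloningLoss_nonneg (a : Fin n → A) (v : Fin n → Fin d → ℝ) : 0 ≤ minCloningLoss a v :=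
  Real.iInf_nonneg fun W => cloningLoss_nonneg a v W

lemma minCloningLoss_le (a : Fin n → A) (v : Fin n → Fin d → ℝ) {W : Matrix A (Fin d) ℝ}
    (hW : W ∈ weightBall A d) : minCloningLoss a v ≤ cloningLoss a v W :=
  ciInf_le (f := fun W : weightBall A d => cloningLoss a v W)
    ⟨0, by rintro _ ⟨W, rfl⟩; exact cloningLoss_nonneg a v W⟩ ⟨W, hW⟩

lemma sum_sqrt_le {n : ℕ} (x : Fin n → ℝ) (hx : ∀ j, 0 ≤ x j) :
    ∑ j, √(x j) ≤ √n * √(∑ j, x j) := by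
  rw [← Real.sqrt_mul n.cast_nonneg]
  refine Real.le_sqrt_of_sq_le ?_
  have h := sq_sum_le_card_mul_sum_sq (s := Finset.univ) (f := fun j => √(x j))
  simp only [Finset.card_univ, Fintype.card_fin, Real.sq_sqrt (hx _)] at h
  exact h

lemma cloningLoss_sub_le (hn : 0 < n) (a : Fin n → A) (v v' : Fin n → Fin d → ℝ)
    {W : Matrix A (Fin d) ℝ} (hW : W ∈ weightBall A d) :
    cloningLoss a v W - cloningLoss a v' W
      ≤ 2 / √n * √(∑ j, ∑ i, (v j i - v' j i) ^ 2) := by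
  have hn' : (0 : ℝ) < n := by exact_mod_cast hn
  unfold cloningLoss
  rw [← mul_sub, ← Finset.sum_sub_distrib]
  calc _ ≤ (1 / (n : ℝ)) * ∑ j, 2 * √(∑ i, (v j i - v' j i) ^ 2) := by
        gcongr with j
        refine (softmaxLoss_sub_le _ _ _).trans (mul_le_mul_of_nonneg_left ?_ zero_le_two)
        have := sqrt_sum_sq_mulVec_le hW (v j - v' j)
        rw [Matrix.mulVec_sub] at this
        simpa using this
    _ ≤ (1 / (n : ℝ)) * (2 * (√n * √(∑ j, ∑ i, (v j i - v' j i) ^ 2))) := by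
        rw [← Finset.mul_sum]
        gcongr
        exact sum_sqrt_le _ fun j => Finset.sum_nonneg fun i _ => sq_nonneg _
    _ = _ := by
        have h := Real.mul_self_sqrt hn'.le
        have h0 : √(n : ℝ) ≠ 0 := (Real.sqrt_pos.2 hn').ne'
        field_simp
        linear_combination (√(∑ j, ∑ i, (v j i - v' j i) ^ 2)) * h

lemma minCloningLoss_sub_le (hn : 0 < n) (a : Fin n → A) (v v' : Fin n → Fin d → ℝ) :
    minCloningLoss a v - minCloningLoss a v'
      ≤ 2 / √n * √(∑ j, ∑ i, (v j i - v' j i) ^ 2) := by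
  have h : minCloningLoss a v - 2 / √n * √(∑ j, ∑ i, (v j i - v' j i) ^ 2)
      ≤ minCloningLoss a v' :=
    le_ciInf fun W => by
      linarith [cloningLoss_sub_le hn a v v' W.2, minCloningLoss_le a v W.2]
  linarith

lemma abs_minCloningLoss_sub_le (hn : 0 < n) (a : Fin n → A) (v v' : Fin n → Fin d → ℝ) :
    |minCloningLoss a v - minCloningLoss a v'|
      ≤ 2 / √n * √(∑ j, ∑ i, (v j i - v' j i) ^ 2) := by
  refine abs_sub_le_iff.2 ⟨minCloningLoss_sub_le hn a v v', ?_⟩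
  have h := minCloningLoss_sub_le hn a v' v
  have hs : ∀ j i, (v' j i - v j i) ^ 2 = (v j i - v' j i) ^ 2 := fun j i => by ring
  simpa only [hs] using h

lemma continuous_minCloningLoss (hn : 0 < n) (a : Fin n → A) :
    Continuous fun v : Fin n → Fin d → ℝ => minCloningLoss a v := by
  refine continuous_iff_continuousAt.2 fun v => ?_
  rw [ContinuousAt, tendsto_iff_dist_tendsto_zero]
  refine squeeze_zero (fun _ => dist_nonneg)
    (fun v' => (Real.dist_eq _ _).trans_le (abs_minCloningLoss_sub_le hn a v' v)) ?_
  have hc : Continuous fun v' : Fin n → Fin d → ℝ =>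
      2 / √n * √(∑ j, ∑ i, (v' j i - v j i) ^ 2) := by fun_prop
  simpa using hc.tendsto v

variable [MeasurableSpace A] [MeasurableSingletonClass A]

lemma measurable_minCloningLoss (hn : 0 < n) :
    Measurable fun p : (Fin n → A) × (Fin n → Fin d → ℝ) => minCloningLoss p.1 p.2 :=
  measurable_from_prod_countable_right fun a => (continuous_minCloningLoss hn a).measurable

lemma measurable_softmaxLoss : Measurable fun p : A × (A → ℝ) => softmaxLoss p.2 p.1 :=
  measurable_from_prod_countable_right fun a => (continuous_softmaxLoss a).measurable

end CloningLoss

section Policies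

variable {S A : Type*} [Fintype A] {d n : ℕ}

/-- The smallest empirical loss of a policy on top of `φ` on the sample `x`. -/
def minEmpLoss (φ : S → EuclideanSpace ℝ (Fin d)) (x : Fin n → S × A) : ℝ :=
  minCloningLoss (fun j => (x j).2) fun j => (φ (x j).1).ofLp

lemma minEmpLoss_nonneg (φ : S → EuclideanSpace ℝ (Fin d)) (x : Fin n → S × A) :
    0 ≤ minEmpLoss φ x := minCloningLoss_nonneg _ _

lemma tendsto_minEmpLoss (hn : 0 < n) {φ : S → EuclideanSpace ℝ (Fin d)}
    {u : ℕ → S → EuclideanSpace ℝ (Fin d)} (hu : ∀ s, Tendsto (fun k => u k s) atTop (𝓝 (φ s)))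
    (x : Fin n → S × A) : Tendsto (fun k => minEmpLoss (u k) x) atTop (𝓝 (minEmpLoss φ x)) := by
  refine ((continuous_minCloningLoss hn fun j => (x j).2).tendsto _).comp ?_
  refine tendsto_pi_nhds.2 fun j => ?_
  exact ((PiLp.continuous_ofLp 2 _).tendsto _).comp (hu _)

lemma lossToError_minEmpLoss_sub_le (hn : 0 < n) (φ φ' : S → EuclideanSpace ℝ (Fin d))
    (x : Fin n → S × A) :
    lossToError (minEmpLoss φ x) - lossToError (minEmpLoss φ' x)
      ≤ 2 / √n * √(∑ k : Fin n × Fin d, (φ (x k.1).1 k.2 - φ' (x k.1).1 k.2) ^ 2) := by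
  rw [Fintype.sum_prod_type]
  exact (lossToError_sub_le (minEmpLoss_nonneg _ _)).trans (abs_minCloningLoss_sub_le hn _ _ _)

variable [MeasurableSpace A]

lemma isProbabilityMeasure_softmaxPolicy [Nonempty A] (φ : S → EuclideanSpace ℝ (Fin d))
    (W : Matrix A (Fin d) ℝ) (s : S) : IsProbabilityMeasure (softmaxPolicy φ W s) := by
  constructor
  rw [softmaxPolicy, Measure.finsetSum_apply]
  simp only [Measure.smul_apply, measure_univ, smul_eq_mul, mul_one]
  rw [← ENNReal.ofReal_sum_of_nonneg fun a _ => softmax_nonneg _ a, sum_softmax, ENNReal.ofReal_one]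

variable [MeasurableSingletonClass A]

lemma softmaxPolicy_real (φ : S → EuclideanSpace ℝ (Fin d)) (W : Matrix A (Fin d) ℝ) (s : S)
    (a : A) : (softmaxPolicy φ W s).real {a} = softmax (W *ᵥ (φ s).ofLp) a := by
  classical
  rw [Measure.real, softmaxPolicy, Measure.finsetSum_apply, Finset.sum_eq_single a]
  · simp [softmax_nonneg]
  · intro b _ hb
    simp [hb]
  · simp

lemma logisticLoss_softmaxPolicy (φ : S → EuclideanSpace ℝ (Fin d)) (W : Matrix A (Fin d) ℝ)
    (s : S) (a : A) :
    logisticLoss (softmaxPolicy φ W s) a = softmaxLoss (W *ᵥ (φ s).ofLp) a := by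
  rw [logisticLoss, softmaxPolicy_real, softmaxLoss]

lemma empLoss_softmaxPolicy (φ : S → EuclideanSpace ℝ (Fin d)) (W : Matrix A (Fin d) ℝ)
    (x : Fin n → S × A) :
    empLoss (softmaxPolicy φ W) x
      = cloningLoss (fun j => (x j).2) (fun j => (φ (x j).1).ofLp) W := by
  simp [empLoss, cloningLoss, logisticLoss_softmaxPolicy]

lemma minEmpLoss_le {φ : S → EuclideanSpace ℝ (Fin d)} {π : S → Measure A}
    (hπ : π ∈ policyClass A φ) (x : Fin n → S × A) : minEmpLoss φ x ≤ empLoss π x := by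
  obtain ⟨W, hW, rfl⟩ := hπ
  rw [empLoss_softmaxPolicy]
  exact minCloningLoss_le _ _ hW

lemma bilevelLoss_eq {T : ℕ} (X : Fin T → Fin n → S × A) (φ : S → EuclideanSpace ℝ (Fin d)) :
    bilevelLoss X φ = (1 / (T : ℝ)) * ∑ t, minEmpLoss φ (X t) := by
  unfold bilevelLoss
  congr 1
  refine Finset.sum_congr rfl fun t _ => ?_
  rw [minEmpLoss, minCloningLoss, iInf]
  congr 1
  ext y
  constructor
  · rintro ⟨_, ⟨W, hW, rfl⟩, rfl⟩
    exact ⟨⟨W, hW⟩, (empLoss_softmaxPolicy φ W (X t)).symm⟩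
  · rintro ⟨W, rfl⟩
    exact ⟨_, ⟨W.1, W.2, rfl⟩, empLoss_softmaxPolicy φ W.1 (X t)⟩

lemma measurable_labels_features {S B : Type*} [MeasurableSpace S] [MeasurableSpace B]
    {φ : S → EuclideanSpace ℝ (Fin d)}
    (hφ : Measurable φ) : Measurable fun x : Fin n → S × B =>
      ((fun j => (x j).2 : Fin n → B), (fun j => (φ (x j).1).ofLp : Fin n → Fin d → ℝ)) := by
  have h1 : Measurable fun (x : Fin n → S × B) j => (x j).2 :=
    measurable_pi_lambda _ fun j => measurable_snd.comp (measurable_pi_apply j)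
  have h2 : Measurable fun (x : Fin n → S × B) j => (φ (x j).1).ofLp :=
    measurable_pi_lambda _ fun j => (WithLp.measurable_ofLp 2 (Fin d → ℝ)).comp
      (hφ.comp (measurable_fst.comp (measurable_pi_apply j)))
  exact h1.prodMk h2

lemma measurable_minEmpLoss [MeasurableSpace S] (hn : 0 < n) {φ : S → EuclideanSpace ℝ (Fin d)}
    (hφ : Measurable φ) : Measurable (minEmpLoss φ : (Fin n → S × A) → ℝ) := by
  have h := (measurable_minCloningLoss (A := A) (d := d) hn).comp
    (measurable_labels_features (B := A) (n := n) hφ)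
  exact h

end Policies

section Value

variable {M S A : Type*} [MeasurableSpace M] [MeasurableSpace S] [MeasurableSpace A]

lemma measurable_value {P : Kernel (M × S × A) S} [IsMarkovKernel P] {C : M → S → A → ℝ}
    (hC : Measurable fun p : M × S × A => C p.1 p.2.1 p.2.2) (π : Kernel (M × S) A)
    [IsMarkovKernel π] (k : ℕ) :
    Measurable fun p : M × S =>
      value (fun s a => P (p.1, s, a)) (C p.1) (fun s => π (p.1, s)) k p.2 := by
  induction k with
  | zero => simp only [value]; exact measurable_const
  | succ k ih =>
    simp only [value]
    have h1 : Measurable fun q : M × S × A => ∫ s', value (fun s a => P (q.1, s, a)) (C q.1)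
        (fun s => π (q.1, s)) k s' ∂(P q) := by
      have h : Measurable fun r : (M × S × A) × S => value (fun s a => P (r.1.1, s, a)) (C r.1.1)
          (fun s => π (r.1.1, s)) k r.2 :=
        ih.comp ((measurable_fst.comp measurable_fst).prodMk measurable_snd)
      exact h.stronglyMeasurable.integral_kernel_prod_right'.measurable
    have h2 : Measurable fun r : (M × S) × A => C r.1.1 r.1.2 r.2
        + ∫ s', value (fun s a => P (r.1.1, s, a)) (C r.1.1) (fun s => π (r.1.1, s)) k s'
          ∂(P (r.1.1, r.1.2, r.2)) :=
      (hC.add h1).comp ((measurable_fst.comp measurable_fst).prodMk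
        ((measurable_snd.comp measurable_fst).prodMk measurable_snd))
    exact h2.stronglyMeasurable.integral_kernel_prod_right'.measurable

lemma abs_integral_le_of_abs_le {Ω : Type*} [MeasurableSpace Ω] (μ : Measure Ω)
    [IsProbabilityMeasure μ] {f : Ω → ℝ} {B : ℝ} (h : ∀ x, |f x| ≤ B) : |∫ x, f x ∂μ| ≤ B := by
  simpa using norm_integral_le_of_norm_le_const (μ := μ) (f := f) (ae_of_all _ h)

lemma abs_value_le {P : S → A → Measure S} [∀ s a, IsProbabilityMeasure (P s a)] {C : S → A → ℝ}
    (hC : ∀ s a, |C s a| ≤ 1) {π : S → Measure A} [∀ s, IsProbabilityMeasure (π s)] (k : ℕ)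
    (s : S) : |value P C π k s| ≤ k := by
  induction k generalizing s with
  | zero => simp [value]
  | succ k ih =>
    rw [value]
    refine abs_integral_le_of_abs_le _ fun a => ?_
    have := abs_integral_le_of_abs_le (P s a) ih
    refine (abs_add_le _ _).trans ?_
    push_cast
    linarith [hC s a]

end Value

section Tasks

variable {M S A : Type*} [MeasurableSpace M] [MeasurableSpace S] [MeasurableSpace A]
  (F : TaskFamily M S A)

instance isMarkovKernel_expertStateLaw (h : ℕ) : IsMarkovKernel (F.expertStateLaw h) := by
  induction h with
  | zero => exact F.markov_init
  | succ h ih => rw [TaskFamily.expertStateLaw]; infer_instance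

lemma isProbabilityMeasure_sampleLaw {H : ℕ} (hH : 1 ≤ H) (m : M) :
    IsProbabilityMeasure (F.sampleLaw H m) := by
  constructor
  simp only [TaskFamily.sampleLaw, Measure.smul_apply, Measure.finsetSum_apply, measure_univ,
    Finset.sum_const, Finset.card_range, nsmul_eq_mul, mul_one, smul_eq_mul]
  exact ENNReal.inv_mul_cancel (by exact_mod_cast (by lia : H ≠ 0)) (ENNReal.natCast_ne_top H)

lemma measurable_sampleLaw (H : ℕ) : Measurable (F.sampleLaw H) := by
  refine Measure.measurable_of_measurable_coe _ fun s hs => ?_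
  simp only [TaskFamily.sampleLaw, Measure.smul_apply, Measure.finsetSum_apply, smul_eq_mul]
  exact (Finset.measurable_sum _ fun h _ => Kernel.measurable_coe _ hs).const_mul _

lemma isProbabilityMeasure_taskDataLaw {H : ℕ} (hH : 1 ≤ H) (n : ℕ) (m : M) :
    IsProbabilityMeasure (F.taskDataLaw H n m) := by
  have := isProbabilityMeasure_sampleLaw F hH m
  unfold TaskFamily.taskDataLaw
  infer_instance

lemma measurable_taskDataLaw {H : ℕ} (hH : 1 ≤ H) (n : ℕ) : Measurable (F.taskDataLaw H n) := by
  have := isProbabilityMeasure_taskDataLaw F hH n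
  have hs := isProbabilityMeasure_sampleLaw F hH
  refine Measurable.measure_of_isPiSystem_of_isProbabilityMeasure generateFrom_pi.symm
    isPiSystem_pi ?_
  rintro _ ⟨s, hs, rfl⟩
  simp only [TaskFamily.taskDataLaw, Measure.pi_pi]
  exact Finset.measurable_prod _ fun j _ =>
    (Measure.measurable_coe (show MeasurableSet (s j) from hs j (Set.mem_univ j))).comp
      (measurable_sampleLaw F H)

/-- The law of `n` expert samples, as a kernel on tasks. -/
def taskDataKernel {H : ℕ} (hH : 1 ≤ H) (n : ℕ) : Kernel M (Fin n → S × A) :=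
  ⟨F.taskDataLaw H n, measurable_taskDataLaw F hH n⟩

lemma taskDataKernel_apply {H : ℕ} (hH : 1 ≤ H) (n : ℕ) (m : M) :
    taskDataKernel F hH n m = F.taskDataLaw H n m := rfl

instance {H : ℕ} (hH : 1 ≤ H) (n : ℕ) : IsMarkovKernel (taskDataKernel F hH n) :=
  ⟨fun m => isProbabilityMeasure_taskDataLaw F hH n m⟩

/-- The probability that a policy errs on a pair of a state and an action drawn from `ρ`. -/
def errorRate (ρ : Measure (S × A)) (π : S → Measure A) : ℝ :=
  ∫ p, (1 - (π p.1).real {p.2}) ∂ρ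

variable [MeasurableSingletonClass A]

lemma integral_expertStateLaw_succ {m : M} {a : S → A}
    (ha : ∀ s, F.expertPolicy m s = Measure.dirac (a s)) (h : ℕ) {f : S → ℝ}
    (hf : Measurable f) {B : ℝ} (hB : ∀ s, |f s| ≤ B) :
    ∫ s, f s ∂(F.expertStateLaw (h + 1) m)
      = ∫ s, ∫ s', f s' ∂(F.trans (m, s, a s)) ∂(F.expertStateLaw h m) := by
  rw [TaskFamily.expertStateLaw, Kernel.snd_apply,
    integral_map (measurable_snd.aemeasurable) hf.aestronglyMeasurable,
    ProbabilityTheory.integral_compProd, ProbabilityTheory.integral_compProd]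
  · refine integral_congr_ae (ae_of_all _ fun s => ?_)
    change ∫ b, ∫ s', f s' ∂(F.trans (m, s, b)) ∂(F.expertPolicy m s) = _
    rw [ha s, integral_dirac]
  · refine integrable_of_abs_le (B := B) ?_ fun p => abs_integral_le_of_abs_le _ fun s => hB s
    have : Measurable fun r : (S × A) × S => f r.2 := hf.comp measurable_snd
    exact (this.stronglyMeasurable.integral_kernel_prod_right'
      (κ := F.trans.comap (Prod.mk m) measurable_prodMk_left)).measurable
  · exact integrable_of_abs_le (hf.comp measurable_snd) fun p => hB _

lemma integral_expertSample {m : M} {a : S → A}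
    (ha : ∀ s, F.expertPolicy m s = Measure.dirac (a s)) (h : ℕ) {f : S × A → ℝ}
    (hf : Measurable f) {B : ℝ} (hB : ∀ p, |f p| ≤ B) :
    ∫ p, f p ∂((F.expertStateLaw h ⊗ₖ F.expert) m)
      = ∫ s, f (s, a s) ∂(F.expertStateLaw h m) := by
  rw [ProbabilityTheory.integral_compProd (integrable_of_abs_le hf hB)]
  refine integral_congr_ae (ae_of_all _ fun s => ?_)
  change ∫ b, f (s, b) ∂(F.expertPolicy m s) = _
  rw [ha s, integral_dirac]

variable [Finite A]

lemma measurable_real_singleton {X : Type*} [MeasurableSpace X] (π : Kernel X A) :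
    Measurable fun p : X × A => (π p.1).real {p.2} := by
  refine measurable_from_prod_countable_left fun a => ?_
  exact (Kernel.measurable_coe π (measurableSet_singleton a)).ennreal_toReal

lemma integral_sub_le_of_abs_le (ρ : Measure A) [IsProbabilityMeasure ρ] {Q : A → ℝ} {B : ℝ}
    (hQ : ∀ b, |Q b| ≤ B) (a : A) : ∫ b, Q b ∂ρ - Q a ≤ 2 * B * (1 - ρ.real {a}) := by
  have hcompl : ρ.real {a}ᶜ = 1 - ρ.real {a} := probReal_compl_eq_one_sub (measurableSet_singleton a)
  calc ∫ b, Q b ∂ρ - Q a = ∫ b, (Q b - Q a) ∂ρ := by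
        rw [integral_sub Integrable.of_finite (integrable_const _)]; simp
    _ ≤ ∫ b, ({a}ᶜ : Set A).indicator (fun _ => 2 * B) b ∂ρ := by
        refine integral_mono Integrable.of_finite Integrable.of_finite fun b => ?_
        by_cases hb : b = a
        · simp [hb]
        · rw [Set.indicator_of_mem (by simpa using hb)]
          linarith [(abs_le.1 (hQ b)).2, (abs_le.1 (hQ a)).1]
    _ = _ := by
        rw [integral_indicator (measurableSet_singleton a).compl, setIntegral_const, hcompl,
          smul_eq_mul, mul_comm]

/-- The regret of a policy with respect to a deterministic expert is at most of the order of the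
squared horizon times its error rate on the expert's distribution. -/
theorem J_sub_le {H : ℕ} (hH : 1 ≤ H) {m : M} (hC : ∀ s a, |F.cost m s a| ≤ 1)
    (hdet : ∀ s, ∃ a, F.expertPolicy m s = Measure.dirac a) (π : Kernel S A) [IsMarkovKernel π] :
    F.J H m π - F.J H m (F.expertPolicy m)
      ≤ 2 * (H : ℝ) ^ 2 * errorRate (F.sampleLaw H m) π := by
  choose a ha using hdet
  set P : S → A → Measure S := fun s a => F.trans (m, s, a) with hP
  have hPp : ∀ s a, IsProbabilityMeasure (P s a) := fun s a => inferInstance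
  have hEp : ∀ s, IsProbabilityMeasure (F.expertPolicy m s) := fun s =>
    inferInstanceAs (IsProbabilityMeasure (F.expert (m, s)))
  set V := fun k => value P (F.cost m) π k with hV
  set U := fun k => value P (F.cost m) (F.expertPolicy m) k with hU
  have hVm : ∀ k, Measurable (V k) := fun k => by
    have := measurable_value (P := F.trans) F.measurable_cost (π.comap Prod.snd measurable_snd) k
    exact this.comp (measurable_prodMk_left (x := m))
  have hUm : ∀ k, Measurable (U k) := fun k => by
    have := measurable_value (P := F.trans) F.measurable_cost F.expert k
    exact this.comp (measurable_prodMk_left (x := m))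
  have hVb : ∀ k s, |V k s| ≤ k := fun k s => abs_value_le hC k s
  have hUb : ∀ k s, |U k s| ≤ k := fun k s => abs_value_le hC k s
  have hreal : Measurable fun p : S × A => 1 - (π p.1).real {p.2} :=
    measurable_const.sub (measurable_real_singleton π)
  have hrb : ∀ p : S × A, |1 - (π p.1).real {p.2}| ≤ 1 := fun p => by
    have h1 : (π p.1).real {p.2} ≤ 1 := measureReal_le_one
    have h0 : 0 ≤ (π p.1).real {p.2} := measureReal_nonneg
    rw [abs_le]; constructor <;> linarith
  set ε : ℕ → ℝ := fun h => errorRate ((F.expertStateLaw h ⊗ₖ F.expert) m) π with hε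
  have hεeq : ∀ h, ε h = ∫ s, (1 - (π s).real {a s}) ∂(F.expertStateLaw h m) := fun h =>
    integral_expertSample F ha h hreal hrb
  have ham' : Measurable a := by
    refine measurable_to_countable' fun b => ?_
    have : a ⁻¹' {b} = (fun s => F.expert (m, s) {b}) ⁻¹' {1} := by
      ext s
      have hs : F.expert (m, s) {b} = Measure.dirac (a s) {b} := by rw [← ha s]; rfl
      by_cases h : a s = b <;> simp [hs, h]
    rw [this]
    exact (Kernel.measurable_coe F.expert (measurableSet_singleton b)).comp measurable_prodMk_left
      (measurableSet_singleton 1)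
  have ham : Measurable fun s => (1 - (π s).real {a s}) :=
    hreal.comp (measurable_id.prodMk ham')
  have step : ∀ k, k < H → ∀ s, V (k + 1) s - U (k + 1) s ≤ 2 * H * (1 - (π s).real {a s})
      + (∫ s', V k s' ∂(P s (a s)) - ∫ s', U k s' ∂(P s (a s))) := fun k hk s => by
    have hk' : (k : ℝ) + 1 ≤ H := by exact_mod_cast hk
    have h1 := integral_sub_le_of_abs_le (π s) (Q := fun b => F.cost m s b + ∫ s', V k s' ∂(P s b))
      (B := H) (fun b => (abs_add_le _ _).trans (by
        linarith [hC s b, abs_integral_le_of_abs_le (P s b) (hVb k)])) (a s)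
    have h2 : U (k + 1) s = F.cost m s (a s) + ∫ s', U k s' ∂(P s (a s)) := by
      simp only [hU, value]
      rw [ha s, integral_dirac]
    have h3 : V (k + 1) s = ∫ b, (F.cost m s b + ∫ s', V k s' ∂(P s b)) ∂(π s) := rfl
    rw [h2, h3]
    linarith
  have key : ∀ k, k ≤ H → ∀ h, ∫ s, V k s ∂(F.expertStateLaw h m) - ∫ s, U k s ∂(F.expertStateLaw h m)
      ≤ 2 * H * ∑ i ∈ Finset.range k, ε (h + i) := by
    intro k
    induction k with
    | zero => intro _ h; simp [hV, hU, value]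
    | succ k ih =>
      intro hk h
      have hVi : ∀ k h, Integrable (V k) (F.expertStateLaw h m) := fun k h =>
        integrable_of_abs_le (hVm k) (hVb k)
      have hUi : ∀ k h, Integrable (U k) (F.expertStateLaw h m) := fun k h =>
        integrable_of_abs_le (hUm k) (hUb k)
      have hPm : ∀ {f : S → ℝ}, Measurable f → ∀ {B : ℝ}, (∀ s, |f s| ≤ B) →
          Integrable (fun s => ∫ s', f s' ∂(P s (a s))) (F.expertStateLaw h m) := by
        intro f hf B hB
        refine integrable_of_abs_le (B := B) ?_ fun s => abs_integral_le_of_abs_le _ hB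
        have h1 : Measurable fun r : S × S => f r.2 := hf.comp measurable_snd
        exact (h1.stronglyMeasurable.integral_kernel_prod_right' (κ := F.trans.comap
          (fun s => (m, s, a s)) (measurable_const.prodMk (measurable_id.prodMk ham')))).measurable
      have hsub : Integrable (fun s => ∫ s', V k s' ∂(P s (a s)) - ∫ s', U k s' ∂(P s (a s)))
          (F.expertStateLaw h m) := (hPm (hVm k) (hVb k)).sub (hPm (hUm k) (hUb k))
      rw [← integral_sub (hVi _ _) (hUi _ _)]
      have hri : Integrable (fun s => (1 - (π s).real {a s})) (F.expertStateLaw h m) :=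
        integrable_of_abs_le ham fun s => hrb (s, a s)
      calc _ ≤ ∫ s, (2 * H * (1 - (π s).real {a s})
            + (∫ s', V k s' ∂(P s (a s)) - ∫ s', U k s' ∂(P s (a s)))) ∂(F.expertStateLaw h m) := by
            refine integral_mono ((hVi _ _).sub (hUi _ _)) ((hri.const_mul _).add hsub) fun s => step k hk s
        _ = 2 * H * ε h + (∫ s, V k s ∂(F.expertStateLaw (h + 1) m)
              - ∫ s, U k s ∂(F.expertStateLaw (h + 1) m)) := by
            rw [integral_add (hri.const_mul _) hsub,
              integral_const_mul, ← hεeq, integral_sub (hPm (hVm k) (hVb k)) (hPm (hUm k) (hUb k)),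
              integral_expertStateLaw_succ F ha h (hVm k) (hVb k),
              integral_expertStateLaw_succ F ha h (hUm k) (hUb k)]
        _ ≤ 2 * H * ε h + 2 * H * ∑ i ∈ Finset.range k, ε (h + 1 + i) := by
            gcongr
            exact ih (by lia) (h + 1)
        _ = _ := by
            rw [Finset.sum_range_succ', mul_add, add_comm]
            simp only [add_zero]
            congr 3
            funext i
            congr 1
            ring
  have hfin := key H le_rfl 0
  have herr : errorRate (F.sampleLaw H m) π = (H : ℝ)⁻¹ * ∑ i ∈ Finset.range H, ε i := by
    rw [errorRate, TaskFamily.sampleLaw, integral_smul_measure, integral_finsetSum_measure]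
    · simp [hε, errorRate]
    · exact fun i _ => integrable_of_abs_le hreal hrb
  simp only [zero_add] at hfin
  have hH' : (H : ℝ) ≠ 0 := by positivity
  have hJ : F.J H m π - F.J H m (F.expertPolicy m) ≤ 2 * H * ∑ i ∈ Finset.range H, ε i := hfin
  rw [herr]
  refine hJ.trans (le_of_eq ?_)
  field_simp

end Tasks

lemma integrable_sq_sum_mul_stdNormal {ι : Type*} [Fintype ι] (u : ι → ℝ) :
    Integrable (fun g : ι → ℝ => (∑ k, g k * u k) ^ 2) (stdNormal ι) :=
  MemLp.integrable_sq (memLp_finsetSum _ fun k _ => (memLp_eval_stdNormal k).mul_const (u k))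

section LinearClass

variable {A : Type*} [Fintype A] {d n : ℕ}

lemma sum_mul_mulVec_le {W : Matrix A (Fin d) ℝ} (hW : W ∈ weightBall A d) (v : Fin n → Fin d → ℝ)
    (g : Fin n × A → ℝ) :
    ∑ j : Fin n × A, g j * (W *ᵥ v j.1) j.2
      ≤ √(∑ p : A × Fin d, (∑ j, g (j, p.1) * v j p.2) ^ 2) := by
  have hW' : ∑ p : A × Fin d, W p.1 p.2 ^ 2 ≤ 1 := by
    rw [Fintype.sum_prod_type]
    simpa [weightBall, Real.sqrt_le_one] using hW
  have heq : ∑ j : Fin n × A, g j * (W *ᵥ v j.1) j.2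
      = ∑ p : A × Fin d, W p.1 p.2 * ∑ j, g (j, p.1) * v j p.2 := by
    simp only [Matrix.mulVec, dotProduct, Fintype.sum_prod_type, Finset.mul_sum]
    rw [Finset.sum_comm]
    refine Finset.sum_congr rfl fun a _ => ?_
    rw [Finset.sum_comm]
    exact Finset.sum_congr rfl fun i _ => Finset.sum_congr rfl fun j _ => by ring
  rw [heq]
  refine Real.le_sqrt_of_sq_le ((Finset.sum_mul_sq_le_sq_mul_sq _ _ _).trans ?_)
  exact mul_le_of_le_one_left (Finset.sum_nonneg fun p _ => sq_nonneg _) hW'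

lemma integral_iSup_linear_le {I : Type*} [Countable I] [Nonempty I] {W : I → Matrix A (Fin d) ℝ}
    (hW : ∀ i, W i ∈ weightBall A d) (v : Fin n → Fin d → ℝ) {R : ℝ} (hR : 0 ≤ R)
    (hv : ∀ j, ∑ i, v j i ^ 2 ≤ R ^ 2) :
    ∫ g : Fin n × A → ℝ, (⨆ i, ∑ j : Fin n × A, g j * (W i *ᵥ v j.1) j.2) ∂(stdNormal (Fin n × A))
      ≤ R * √(n * Fintype.card A) := by
  classical
  set c := R * √(n * Fintype.card A) with hc
  have hc0 : 0 ≤ c := by positivity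
  set Y : (Fin n × A → ℝ) → ℝ := fun g => ∑ p : A × Fin d, (∑ j, g (j, p.1) * v j p.2) ^ 2 with hY
  have hlin : ∀ (p : A × Fin d) (g : Fin n × A → ℝ), ∑ j, g (j, p.1) * v j p.2
      = ∑ q : Fin n × A, g q * (if q.2 = p.1 then v q.1 p.2 else 0) := fun p g => by
    rw [Fintype.sum_prod_type]
    simp
  have hYi : Integrable Y (stdNormal (Fin n × A)) := by
    refine integrable_finsetSum _ fun p _ => ?_
    simp_rw [hlin p]
    exact integrable_sq_sum_mul_stdNormal _
  have hYint : ∫ g, Y g ∂(stdNormal (Fin n × A)) ≤ c ^ 2 := by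
    rw [integral_finsetSum]
    · simp_rw [hlin, integral_sq_sum_mul_stdNormal]
      have : ∀ p : A × Fin d, ∑ q : Fin n × A, (if q.2 = p.1 then v q.1 p.2 else 0) ^ 2
          = ∑ j, v j p.2 ^ 2 := fun p => by
        rw [Fintype.sum_prod_type]
        simp
      simp_rw [this]
      rw [Fintype.sum_prod_type]
      simp only [Finset.sum_const, Finset.card_univ, nsmul_eq_mul]
      rw [Finset.sum_comm, hc, mul_pow, Real.sq_sqrt (by positivity)]
      calc (Fintype.card A : ℝ) * ∑ j, ∑ i, v j i ^ 2 ≤ Fintype.card A * ∑ j : Fin n, R ^ 2 := by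
            gcongr with j
            exact hv j
        _ = _ := by simp; ring
    · intro p _
      simp_rw [hlin p]
      exact integrable_sq_sum_mul_stdNormal _
  refine le_of_forall_pos_le_add fun r hr => ?_
  have hcr : 0 < c + r := by positivity
  calc _ ≤ ∫ g, (Y g / (2 * (c + r)) + (c + r) / 2) ∂(stdNormal (Fin n × A)) := by
        have hwb : ∀ i (j : Fin n × A), |(W i *ᵥ v j.1) j.2| ≤ R := fun i j => by
          refine (Real.abs_le_sqrt (Finset.single_le_sum (f := fun a => (W i *ᵥ v j.1) a ^ 2)
            (fun b _ => sq_nonneg _) (Finset.mem_univ j.2))).trans ?_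
          refine (sqrt_sum_sq_mulVec_le (hW i) (v j.1)).trans ?_
          exact (Real.sqrt_le_sqrt (hv j.1)).trans (Real.sqrt_sq hR).le
        have hint := integrable_iSup_gaussian (B := fun _ : I => 0)
          (w := fun i (j : Fin n × A) => (W i *ᵥ v j.1) j.2) (C := R) (by simpa using hR) hwb
        simp only [zero_add] at hint
        refine integral_mono hint ((hYi.div_const _).add (integrable_const _)) fun g => ?_
        refine ciSup_le fun i => (sum_mul_mulVec_le (hW i) v g).trans ?_
        have hY0 : 0 ≤ Y g := Finset.sum_nonneg fun p _ => sq_nonneg _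
        have hs := Real.sq_sqrt hY0
        change √(Y g) ≤ Y g / (2 * (c + r)) + (c + r) / 2
        rw [← sub_nonneg]
        have : Y g / (2 * (c + r)) + (c + r) / 2 - √(Y g)
            = (√(Y g) - (c + r)) ^ 2 / (2 * (c + r)) := by
          field_simp
          linear_combination -hs
        rw [this]
        positivity
    _ = (∫ g, Y g ∂(stdNormal (Fin n × A))) / (2 * (c + r)) + (c + r) / 2 := by
        rw [integral_add (hYi.div_const _) (integrable_const _), integral_div]
        simp
    _ ≤ (c + r) ^ 2 / (2 * (c + r)) + (c + r) / 2 := by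
        gcongr
        nlinarith
    _ = c + r := by field_simp; ring

end LinearClass

section Generalization

lemma errorRate_mem_Icc {S A : Type*} [MeasurableSpace S] [MeasurableSpace A]
    {ρ : Measure (S × A)} [IsProbabilityMeasure ρ] (κ : S → Measure A) [∀ s, IsProbabilityMeasure (κ s)] :
    errorRate ρ κ ∈ Set.Icc 0 1 := by
  have h0 : ∀ p : S × A, 0 ≤ 1 - (κ p.1).real {p.2} := fun p => sub_nonneg.2 measureReal_le_one
  refine ⟨integral_nonneg h0, ?_⟩
  refine (integral_mono_of_nonneg (ae_of_all _ h0) (integrable_const 1)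
    (ae_of_all _ fun p => sub_le_self _ measureReal_nonneg)).trans (by simp)

variable {S A : Type*} [Fintype A] {d n : ℕ}

/-- The error of the softmax policy with weights `W` on a pair of a state and an action. -/
def softmaxError (φ : S → EuclideanSpace ℝ (Fin d)) (W : Matrix A (Fin d) ℝ) (p : S × A) : ℝ :=
  lossToError (softmaxLoss (W *ᵥ (φ p.1).ofLp) p.2)

lemma softmaxError_nonneg (φ : S → EuclideanSpace ℝ (Fin d)) (W : Matrix A (Fin d) ℝ)
    (p : S × A) : 0 ≤ softmaxError φ W p := lossToError_nonneg (softmaxLoss_nonneg _ _)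

lemma softmaxError_le_one (φ : S → EuclideanSpace ℝ (Fin d)) (W : Matrix A (Fin d) ℝ)
    (p : S × A) : softmaxError φ W p ≤ 1 := lossToError_le_one _

lemma continuous_softmaxError (φ : S → EuclideanSpace ℝ (Fin d)) (p : S × A) :
    Continuous fun W : Matrix A (Fin d) ℝ => softmaxError φ W p :=
  continuous_lossToError.comp ((continuous_softmaxLoss p.2).comp
    (continuous_id.matrix_mulVec continuous_const))

instance : SecondCountableTopology (Matrix A (Fin d) ℝ) :=
  inferInstanceAs (SecondCountableTopology (A → Fin d → ℝ))

/-- A dense sequence of weight matrices of Frobenius norm at most one. -/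
def denseWeights (A : Type*) [Fintype A] (d : ℕ) : ℕ → Matrix A (Fin d) ℝ := fun i =>
  (TopologicalSpace.denseSeq (weightBall A d) i).1

lemma denseWeights_mem (i : ℕ) : denseWeights A d i ∈ weightBall A d :=
  (TopologicalSpace.denseSeq (weightBall A d) i).2

lemma rademacherAverage_softmaxError_le {φ : S → EuclideanSpace ℝ (Fin d)} {R : ℝ}
    (hR : ∀ s, ‖φ s‖ ≤ R) (hR0 : 0 ≤ R) (x : Fin n → S × A) :
    rademacherAverage (fun i j => softmaxError φ (denseWeights A d i) (x j))
      ≤ 6 * (R * √(n * Fintype.card A)) := by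
  set v : Fin n → Fin d → ℝ := fun j => (φ (x j).1).ofLp with hv
  have hvR : ∀ j, ∑ i, v j i ^ 2 ≤ R ^ 2 := fun j => by
    have h := EuclideanSpace.real_norm_sq_eq (φ (x j).1)
    rw [← h]
    exact pow_le_pow_left₀ (norm_nonneg _) (hR _) 2
  have h := rademacherAverage_le_gaussian (Equiv.refl (Fin n × A))
    (fun i j => softmaxError φ (denseWeights A d i) (x j))
    (fun i p => (denseWeights A d i *ᵥ v p.1) p.2) (C := max 1 R) (L := 2) (by norm_num)
    (fun i j => (abs_le_one_of_mem (fun i => softmaxError_nonneg φ (denseWeights A d i))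
      (fun i => softmaxError_le_one φ (denseWeights A d i)) i (x j)).trans (le_max_left _ _))
    (fun i j => ?_) (fun i i' j => ?_)
  · refine h.trans ?_
    have h2 := integral_iSup_linear_le (fun i => denseWeights_mem (A := A) (d := d) i) v hR0 hvR
    linarith
  · refine le_trans ?_ (le_max_right _ _)
    refine (Real.abs_le_sqrt (Finset.single_le_sum
      (f := fun a => (denseWeights A d i *ᵥ v j.1) a ^ 2) (fun b _ => sq_nonneg _)
      (Finset.mem_univ j.2))).trans ?_
    refine (sqrt_sum_sq_mulVec_le (denseWeights_mem i) (v j.1)).trans ?_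
    exact (Real.sqrt_le_sqrt (hvR j.1)).trans (Real.sqrt_sq hR0).le
  · have hL := fun y y' : A → ℝ => abs_sub_le_iff.2 ⟨softmaxLoss_sub_le y y' (x j).2,
      (softmaxLoss_sub_le y' y (x j).2).trans_eq (by simp_rw [← neg_sub (y _) (y' _), neg_sq])⟩
    exact (lossToError_sub_le (softmaxLoss_nonneg _ _)).trans (hL _ _)

variable [MeasurableSpace S] [MeasurableSpace A]

lemma IsCloning.isProbabilityMeasure [Nonempty A] {φ : S → EuclideanSpace ℝ (Fin d)}
    {bc : (Fin n → S × A) → S → Measure A} (h : IsCloning φ bc) (x : Fin n → S × A) (s : S) :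
    IsProbabilityMeasure (bc x s) := by
  obtain ⟨W, -, hW⟩ := h.mem x
  rw [hW]
  exact isProbabilityMeasure_softmaxPolicy φ W s

/-- The policies found by behavioral cloning, as a kernel. -/
def cloningKernel {φ : S → EuclideanSpace ℝ (Fin d)} {bc : (Fin n → S × A) → S → Measure A}
    (h : IsCloning φ bc) : Kernel ((Fin n → S × A) × S) A := ⟨fun p => bc p.1 p.2, h.measurable⟩

lemma isMarkovKernel_cloningKernel [Nonempty A] {φ : S → EuclideanSpace ℝ (Fin d)}
    {bc : (Fin n → S × A) → S → Measure A} (h : IsCloning φ bc) :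
    IsMarkovKernel (cloningKernel h) := ⟨fun p => h.isProbabilityMeasure p.1 p.2⟩

variable [MeasurableSingletonClass A]

lemma errorRate_softmaxPolicy (ρ : Measure (S × A)) (φ : S → EuclideanSpace ℝ (Fin d))
    (W : Matrix A (Fin d) ℝ) :
    errorRate ρ (softmaxPolicy φ W) = ∫ p, softmaxError φ W p ∂ρ := by
  simp only [errorRate, softmaxPolicy_real, softmaxError, lossToError_softmaxLoss]

lemma measurable_softmaxError {φ : S → EuclideanSpace ℝ (Fin d)} (hφ : Measurable φ)
    (W : Matrix A (Fin d) ℝ) : Measurable (softmaxError φ W) := by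
  have h1 : Measurable fun p : S × A => W *ᵥ (φ p.1).ofLp :=
    (show Continuous fun v : Fin d → ℝ => W *ᵥ v by fun_prop).measurable.comp
      ((WithLp.measurable_ofLp 2 (Fin d → ℝ)).comp (hφ.comp measurable_fst))
  exact continuous_lossToError.measurable.comp
    (measurable_softmaxLoss.comp (measurable_snd.prodMk h1))

variable {ρ : Measure (S × A)} [IsProbabilityMeasure ρ]

lemma mean_sub_sum_le_deviation {φ : S → EuclideanSpace ℝ (Fin d)} (hφ : Measurable φ)
    (x : Fin n → S × A) {W : Matrix A (Fin d) ℝ} (hW : W ∈ weightBall A d) :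
    n * ∫ p, softmaxError φ W p ∂ρ - ∑ j, softmaxError φ W (x j)
      ≤ deviation ρ (fun i => softmaxError φ (denseWeights A d i)) x := by
  have hc : Continuous fun W : Matrix A (Fin d) ℝ =>
      n * ∫ p, softmaxError φ W p ∂ρ - ∑ j, softmaxError φ W (x j) := by
    refine (continuous_const.mul ?_).sub
      (continuous_finsetSum _ fun j _ => continuous_softmaxError φ (x j))
    refine continuous_of_dominated (bound := fun _ => 1)
      (fun W => (measurable_softmaxError hφ W).aestronglyMeasurable)
      (fun W => ae_of_all _ fun p => ?_) (integrable_const _)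
      (ae_of_all _ fun p => continuous_softmaxError φ p)
    rw [Real.norm_of_nonneg (softmaxError_nonneg _ _ _)]
    exact softmaxError_le_one _ _ _
  have h := (TopologicalSpace.denseRange_denseSeq (weightBall A d)).induction_on
    (p := fun W : weightBall A d => n * ∫ p, softmaxError φ W.1 p ∂ρ - ∑ j, softmaxError φ W.1 (x j)
      ≤ deviation ρ (fun i => softmaxError φ (denseWeights A d i)) x) ⟨W, hW⟩
    (isClosed_le (hc.comp continuous_subtype_val) continuous_const) fun i => ?_
  · exact h
  · exact le_deviation (P := ρ) (f := fun i => softmaxError φ (denseWeights A d i))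
      (fun i => softmaxError_nonneg _ _) (fun i => softmaxError_le_one _ _) i x

lemma measurable_errorRate_cloning [Nonempty A] {φ : S → EuclideanSpace ℝ (Fin d)}
    {bc : (Fin n → S × A) → S → Measure A} (h : IsCloning φ bc) :
    Measurable fun x => errorRate ρ (bc x) := by
  have h1 : Measurable fun q : (Fin n → S × A) × S × A => 1 - (bc q.1 q.2.1).real {q.2.2} :=
    (measurable_const.sub (measurable_real_singleton (cloningKernel h))).comp
      ((measurable_fst.prodMk (measurable_fst.comp measurable_snd)).prodMk
        (measurable_snd.comp measurable_snd))
  exact h1.stronglyMeasurable.integral_prod_right'.measurable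

/-- The expected error rate of behavioral cloning on a fixed representation is controlled by its
empirical loss. -/
theorem integral_errorRate_cloning_le [Nonempty A] (hn : 0 < n)
    {φ : S → EuclideanSpace ℝ (Fin d)} (hφ : Measurable φ) {R : ℝ} (hR : ∀ s, ‖φ s‖ ≤ R)
    (hR0 : 0 ≤ R) {bc : (Fin n → S × A) → S → Measure A} (h : IsCloning φ bc) :
    ∫ x, errorRate ρ (bc x) ∂(Measure.pi fun _ => ρ)
      ≤ ∫ x : Fin n → S × A, lossToError (minEmpLoss φ x) ∂(Measure.pi fun _ => ρ)
        + 12 * (R * √(Fintype.card A) / √n) := by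
  have hn' : (0 : ℝ) < n := by exact_mod_cast hn
  set f : ℕ → S × A → ℝ := fun i => softmaxError φ (denseWeights A d i) with hf
  have hf0 : ∀ i p, 0 ≤ f i p := fun i => softmaxError_nonneg _ _
  have hf1 : ∀ i p, f i p ≤ 1 := fun i => softmaxError_le_one _ _
  have hfm : ∀ i, Measurable (f i) := fun i => measurable_softmaxError hφ _
  have hpt : ∀ x : Fin n → S × A, errorRate ρ (bc x)
      ≤ lossToError (minEmpLoss φ x) + (1 / (n : ℝ)) * deviation ρ f x := fun x => by
    obtain ⟨W, hW, hbc⟩ := h.mem x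
    have h1 := mean_sub_sum_le_deviation (ρ := ρ) hφ x hW
    have h2 : (1 / (n : ℝ)) * ∑ j, softmaxError φ W (x j) ≤ lossToError (minEmpLoss φ x) := by
      refine (mean_lossToError_le hn _).trans (lossToError_mono ?_)
      refine le_ciInf fun W' => ?_
      have := h.min x _ ⟨W'.1, W'.2, rfl⟩
      rwa [hbc, empLoss_softmaxPolicy, empLoss_softmaxPolicy] at this
    rw [hbc, errorRate_softmaxPolicy]
    have h3 : ∫ p, softmaxError φ W p ∂ρ = (1 / (n : ℝ)) * ∑ j, softmaxError φ W (x j)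
        + (1 / (n : ℝ)) * (n * ∫ p, softmaxError φ W p ∂ρ - ∑ j, softmaxError φ W (x j)) := by
      field_simp
      ring
    rw [h3]
    exact add_le_add h2 (mul_le_mul_of_nonneg_left h1 (by positivity))
  have hi1 : Integrable (fun x => errorRate ρ (bc x)) (Measure.pi fun _ => ρ) := by
    refine integrable_of_abs_le (B := 1) (measurable_errorRate_cloning h) fun x => ?_
    have := h.isProbabilityMeasure x
    have hm := errorRate_mem_Icc (ρ := ρ) (bc x)
    exact abs_le.2 ⟨by linarith [hm.1], hm.2⟩
  have hi2 : Integrable (fun x : Fin n → S × A => lossToError (minEmpLoss φ x))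
      (Measure.pi fun _ => ρ) :=
    integrable_of_abs_le (B := 1)
      (continuous_lossToError.measurable.comp (measurable_minEmpLoss hn hφ)) fun x =>
        abs_le.2 ⟨by linarith [lossToError_nonneg (minEmpLoss_nonneg φ x)], lossToError_le_one _⟩
  have hi3 : Integrable (fun x : Fin n → S × A => deviation ρ f x) (Measure.pi fun _ => ρ) :=
    integrable_of_abs_le (measurable_deviation hfm) (abs_deviation_le hf0 hf1)
  have hdev : ∫ x : Fin n → S × A, deviation ρ f x ∂(Measure.pi fun _ => ρ)
      ≤ 2 * (6 * (R * √(n * Fintype.card A))) := by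
    refine (integral_deviation_le hfm hf0 hf1).trans ?_
    gcongr
    have hRm := measurable_rademacherAverage (N := n) hfm
    calc _ ≤ ∫ x : Fin n → S × A, 6 * (R * √(n * Fintype.card A)) ∂(Measure.pi fun _ => ρ) := by
          refine integral_mono (integrable_of_abs_le hRm fun z => abs_rademacherAverage_le fun i t =>
            abs_le_one_of_mem hf0 hf1 i _) (integrable_const _) fun x => ?_
          exact rademacherAverage_softmaxError_le hR hR0 x
      _ = _ := by simp
  calc _ ≤ ∫ x : Fin n → S × A, (lossToError (minEmpLoss φ x) + (1 / (n : ℝ)) * deviation ρ f x)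
        ∂(Measure.pi fun _ => ρ) := integral_mono hi1 (hi2.add (hi3.const_mul _)) hpt
    _ = ∫ x : Fin n → S × A, lossToError (minEmpLoss φ x) ∂(Measure.pi fun _ => ρ)
        + (1 / (n : ℝ)) * ∫ x : Fin n → S × A, deviation ρ f x ∂(Measure.pi fun _ => ρ) := by
        rw [integral_add hi2 (hi3.const_mul _), integral_const_mul]
    _ ≤ ∫ x : Fin n → S × A, lossToError (minEmpLoss φ x) ∂(Measure.pi fun _ => ρ)
        + (1 / (n : ℝ)) * (2 * (6 * (R * √(n * Fintype.card A)))) := by gcongr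
    _ = _ := by
        rw [Real.sqrt_mul hn'.le]
        have hs := Real.mul_self_sqrt hn'.le
        have h0 : √(n : ℝ) ≠ 0 := (Real.sqrt_pos.2 hn').ne'
        field_simp
        linear_combination (12 * R * √(Fintype.card A)) * hs

end Generalization

section GaussianAverage

lemma abs_apply_le_norm {d : ℕ} (v : EuclideanSpace ℝ (Fin d)) (k : Fin d) : |v k| ≤ ‖v‖ :=
  PiLp.norm_apply_le v k

/-- The Gaussian average of a class is that of a subclass that is dense for pointwise
convergence. -/
lemma gaussianAverage_eq_of_dense {S ι : Type*} [Fintype ι] {d : ℕ}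
    {Φ Φ₀ : Set (S → EuclideanSpace ℝ (Fin d))} (hsub : Φ₀ ⊆ Φ) (hne : Φ.Nonempty) {R : ℝ}
    (hR : ∀ φ ∈ Φ, ∀ s, ‖φ s‖ ≤ R)
    (hdense : ∀ φ ∈ Φ, ∃ u : ℕ → S → EuclideanSpace ℝ (Fin d),
      (∀ k, u k ∈ Φ₀) ∧ ∀ s, Tendsto (fun k => u k s) atTop (𝓝 (φ s))) (p : ι → S) :
    gaussianAverage Φ p
      = ∫ g : Fin d × ι → ℝ, (⨆ φ : Φ₀, ∑ k : Fin d × ι, g k * φ.1 (p k.2) k.1)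
          ∂(stdNormal (Fin d × ι)) := by
  unfold gaussianAverage
  congr 1
  funext g
  have : Nonempty Φ := hne.to_subtype
  have : Nonempty Φ₀ := by
    obtain ⟨φ, hφ⟩ := hne
    obtain ⟨u, hu, -⟩ := hdense φ hφ
    exact ⟨⟨u 0, hu 0⟩⟩
  have hb : ∀ φ ∈ Φ, |∑ k : Fin d × ι, g k * φ (p k.2) k.1| ≤ ∑ k, |g k| * R := fun φ hφ =>
    abs_sum_mul_le g _ fun k => (abs_apply_le_norm _ _).trans (hR φ hφ _)
  have hb0 : BddAbove (Set.range fun φ : Φ₀ => ∑ k : Fin d × ι, g k * φ.1 (p k.2) k.1) :=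
    bddAbove_range_of_abs_le fun φ => hb φ.1 (hsub φ.2)
  refine le_antisymm (ciSup_le fun φ => ?_) (ciSup_le fun φ => ?_)
  · obtain ⟨u, hu, hlim⟩ := hdense φ.1 φ.2
    have ht : Tendsto (fun i => ∑ k : Fin d × ι, g k * u i (p k.2) k.1) atTop
        (𝓝 (∑ k : Fin d × ι, g k * φ.1 (p k.2) k.1)) := by
      refine tendsto_finsetSum _ fun k _ => Tendsto.const_mul _ ?_
      exact ((PiLp.continuous_apply 2 _ k.1).tendsto _).comp (hlim (p k.2))
    exact le_of_tendsto' ht fun i => le_ciSup hb0 (⟨u i, hu i⟩ : Φ₀)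
  · exact le_ciSup (f := fun φ : Φ => ∑ k : Fin d × ι, g k * φ.1 (p k.2) k.1)
      (bddAbove_range_of_abs_le fun φ => hb φ.1 φ.2) ⟨φ.1, hsub φ.2⟩

end GaussianAverage

section Tasks

variable {M S A : Type*} [MeasurableSpace M] [MeasurableSpace S] [MeasurableSpace A]
  (F : TaskFamily M S A)

lemma measurable_J {X : Type*} [MeasurableSpace X] {g : X → M} (hg : Measurable g)
    (π : Kernel (X × S) A) [IsMarkovKernel π] (H : ℕ) :
    Measurable fun x => F.J H (g x) fun s => π (x, s) := by
  have h1 : Measurable fun q : X × S × A => (g q.1, q.2.1, q.2.2) :=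
    (hg.comp measurable_fst).prodMk measurable_snd
  have h := measurable_value (P := F.trans.comap _ h1) (C := fun x => F.cost (g x))
    (F.measurable_cost.comp h1) π H
  exact (h.stronglyMeasurable.integral_kernel_prod_right' (κ := F.init.comap g hg)).measurable

lemma abs_J_le {m : M} (hC : ∀ s a, |F.cost m s a| ≤ 1) {π : S → Measure A}
    [∀ s, IsProbabilityMeasure (π s)] (H : ℕ) : |F.J H m π| ≤ H :=
  abs_integral_le_of_abs_le _ fun s => abs_value_le (P := fun s a => F.trans (m, s, a)) hC H s

lemma integral_bind_taskDataLaw {H : ℕ} (hH : 1 ≤ H) (n : ℕ) (η : Measure M)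
    [IsProbabilityMeasure η] {f : (Fin n → S × A) → ℝ} (hf : Measurable f) {B : ℝ}
    (hB : ∀ x, |f x| ≤ B) :
    ∫ x, f x ∂(η.bind (F.taskDataLaw H n)) = ∫ m, ∫ x, f x ∂(F.taskDataLaw H n m) ∂η := by
  have h : η.bind (F.taskDataLaw H n) = (η ⊗ₘ taskDataKernel F hH n).snd :=
    (Measure.snd_compProd η (taskDataKernel F hH n)).symm
  have hi : Integrable (fun p : M × (Fin n → S × A) => f p.2) (η ⊗ₘ taskDataKernel F hH n) :=
    integrable_of_abs_le (hf.comp measurable_snd) fun p => hB _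
  rw [h, Measure.snd, integral_map measurable_snd.aemeasurable hf.aestronglyMeasurable,
    Measure.integral_compProd hi]
  rfl

lemma isProbabilityMeasure_bind_taskDataLaw {H : ℕ} (hH : 1 ≤ H) (n : ℕ) (η : Measure M)
    [IsProbabilityMeasure η] : IsProbabilityMeasure (η.bind (F.taskDataLaw H n)) := by
  have h : η.bind (F.taskDataLaw H n) = (η ⊗ₘ taskDataKernel F hH n).snd :=
    (Measure.snd_compProd η (taskDataKernel F hH n)).symm
  rw [h]
  infer_instance

variable [Fintype A] [MeasurableSingletonClass A] {d n : ℕ}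

lemma ae_sampleLaw_of_realizable {H : ℕ} {m : M}
    {φ : S → EuclideanSpace ℝ (Fin d)} (hφ : Measurable φ) {γ : ℝ}
    (hdet : ∀ s, ∃ a, F.expertPolicy m s = Measure.dirac a) {π : S → Measure A}
    (hπ : π ∈ policyClass A φ)
    (hreal : ∀ s a, (∀ b, (F.expertPolicy m s).real {b} ≤ (F.expertPolicy m s).real {a}) →
      1 - γ ≤ (π s).real {a}) :
    ∀ᵐ p ∂(F.sampleLaw H m), 1 - γ ≤ (π p.1).real {p.2} := by
  obtain ⟨W, -, rfl⟩ := hπ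
  set q : S × A → ℝ := fun p => (softmaxPolicy φ W p.1).real {p.2} with hq
  have hqm : Measurable q := by
    have : q = fun p => 1 - softmaxError φ W p := by
      funext p
      rw [softmaxError, lossToError_softmaxLoss, ← softmaxPolicy_real, sub_sub_cancel]
    rw [this]
    exact measurable_const.sub (measurable_softmaxError hφ W)
  have hms : MeasurableSet {p : S × A | 1 - γ ≤ q p} := measurableSet_le measurable_const hqm
  have hpt : ∀ s, ∀ᵐ a ∂(F.expertPolicy m s), 1 - γ ≤ q (s, a) := fun s => by
    obtain ⟨a, ha⟩ := hdet s
    have h1 := hreal s a fun b => by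
      rw [ha]
      refine measureReal_le_one.trans (le_of_eq ?_)
      simp [Measure.real]
    rw [ha, ae_dirac_eq]
    exact h1
  have hlevel : ∀ h, ∀ᵐ p ∂((F.expertStateLaw h ⊗ₖ F.expert) m), 1 - γ ≤ q p := fun h =>
    Kernel.ae_compProd_of_ae_ae (p := fun p => 1 - γ ≤ q p) hms (ae_of_all _ hpt)
  rw [ae_iff]
  simp only [TaskFamily.sampleLaw, Measure.smul_apply, Measure.finsetSum_apply, smul_eq_mul]
  rw [Finset.sum_eq_zero fun h _ => ae_iff.1 (hlevel h), mul_zero]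

lemma ae_minEmpLoss_le {H : ℕ} (hH : 1 ≤ H) (hn : 0 < n) (η : Measure M)
    {φ : S → EuclideanSpace ℝ (Fin d)} (hφ : Measurable φ) {γ : ℝ} (hγ : γ < 1)
    (hdet : ∀ᵐ m ∂η, ∀ s, ∃ a, F.expertPolicy m s = Measure.dirac a)
    (hreal : ∀ᵐ m ∂η, ∃ π ∈ policyClass A φ, ∀ s a,
      (∀ b, (F.expertPolicy m s).real {b} ≤ (F.expertPolicy m s).real {a}) →
        1 - γ ≤ (π s).real {a}) :
    ∀ᵐ x ∂(η.bind (F.taskDataLaw H n)), minEmpLoss φ x ≤ -Real.log (1 - γ) := by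
  refine Measure.ae_comp_of_ae_ae (κ := taskDataKernel F hH n)
    (measurableSet_le (measurable_minEmpLoss hn hφ) measurable_const) ?_
  filter_upwards [hdet, hreal] with m hdet hreal
  obtain ⟨π, hπ, hπr⟩ := hreal
  have := isProbabilityMeasure_sampleLaw F hH m
  have hall : ∀ᵐ x ∂(F.taskDataLaw H n m), ∀ j, 1 - γ ≤ (π (x j).1).real {(x j).2} :=
    ae_all_iff.2 fun j => (measurePreserving_eval (fun _ : Fin n => F.sampleLaw H m)
      j).quasiMeasurePreserving.ae (ae_sampleLaw_of_realizable F hφ hdet hπ hπr)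
  rw [taskDataKernel_apply]
  filter_upwards [hall] with x hx
  refine (minEmpLoss_le hπ x).trans ?_
  have hn' : (0 : ℝ) < n := by exact_mod_cast hn
  calc empLoss π x ≤ (1 / (n : ℝ)) * ∑ j : Fin n, -Real.log (1 - γ) := by
        unfold empLoss logisticLoss
        refine mul_le_mul_of_nonneg_left (Finset.sum_le_sum fun j _ => ?_) (by positivity)
        exact neg_le_neg (Real.log_le_log (by linarith) (hx j))
    _ = -Real.log (1 - γ) := by
        simp only [Finset.sum_const, Finset.card_univ, Fintype.card_fin, nsmul_eq_mul]
        field_simp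

/-- The expected regret of behavioral cloning on a fixed representation is controlled by its
expected empirical loss. -/
lemma regret_cloning_le {H : ℕ} (hH : 1 ≤ H) (hn : 0 < n) (η : Measure M) [IsProbabilityMeasure η]
    [Nonempty A] (hC : ∀ m s a, |F.cost m s a| ≤ 1)
    (hdet : ∀ᵐ m ∂η, ∀ s, ∃ a, F.expertPolicy m s = Measure.dirac a)
    {φ : S → EuclideanSpace ℝ (Fin d)} (hφ : Measurable φ) {R : ℝ} (hR : ∀ s, ‖φ s‖ ≤ R)
    (hR0 : 0 ≤ R) {bc : (Fin n → S × A) → S → Measure A} (h : IsCloning φ bc) :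
    (∫ m, ∫ x, F.J H m (bc x) ∂(F.taskDataLaw H n m) ∂η) - ∫ m, F.J H m (F.expertPolicy m) ∂η
      ≤ 2 * (H : ℝ) ^ 2 * (∫ x, lossToError (minEmpLoss φ x) ∂(η.bind (F.taskDataLaw H n))
        + 12 * (R * √(Fintype.card A) / √n)) := by
  have := isMarkovKernel_cloningKernel h
  have hbcp := h.isProbabilityMeasure
  have hEp : ∀ m s, IsProbabilityMeasure (F.expertPolicy m s) := fun m s =>
    inferInstanceAs (IsProbabilityMeasure (F.expert (m, s)))
  have hKp := isProbabilityMeasure_taskDataLaw F hH n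
  have hLm : Measurable fun x : Fin n → S × A => lossToError (minEmpLoss φ x) :=
    continuous_lossToError.measurable.comp (measurable_minEmpLoss hn hφ)
  have hLb : ∀ x : Fin n → S × A, |lossToError (minEmpLoss φ x)| ≤ 1 := fun x =>
    abs_le.2 ⟨by linarith [lossToError_nonneg (minEmpLoss_nonneg φ x)], lossToError_le_one _⟩
  have hJbc : Measurable fun q : M × (Fin n → S × A) => F.J H q.1 (bc q.2) :=
    measurable_J F measurable_fst ((cloningKernel h).comap
      (fun q : (M × (Fin n → S × A)) × S => (q.1.2, q.2))
      ((measurable_snd.comp measurable_fst).prodMk measurable_snd)) H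
  have hJx : ∀ m, Measurable fun x => F.J H m (bc x) := fun m =>
    hJbc.comp (measurable_prodMk_left (x := m))
  have hJb : ∀ m x, |F.J H m (bc x)| ≤ H := fun m x => abs_J_le F (hC m) H
  have hEm : Measurable fun m => F.J H m (F.expertPolicy m) := measurable_J F measurable_id F.expert H
  have hEb : ∀ m, |F.J H m (F.expertPolicy m)| ≤ H := fun m => abs_J_le F (hC m) H
  have hAm : Measurable fun m => ∫ x, F.J H m (bc x) ∂(F.taskDataLaw H n m) :=
    (hJbc.stronglyMeasurable.integral_kernel_prod_right' (κ := taskDataKernel F hH n)).measurable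
  have hAi : Integrable (fun m => ∫ x, F.J H m (bc x) ∂(F.taskDataLaw H n m)) η :=
    integrable_of_abs_le hAm fun m => abs_integral_le_of_abs_le _ (hJb m)
  have hEi : Integrable (fun m => F.J H m (F.expertPolicy m)) η := integrable_of_abs_le hEm hEb
  have hLLm : Measurable fun m => ∫ x, lossToError (minEmpLoss φ x) ∂(F.taskDataLaw H n m) :=
    ((hLm.comp measurable_snd).stronglyMeasurable.integral_kernel_prod_right'
      (κ := taskDataKernel F hH n)).measurable
  have hLLi : Integrable (fun m => ∫ x, lossToError (minEmpLoss φ x) ∂(F.taskDataLaw H n m)) η :=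
    integrable_of_abs_le hLLm fun m => abs_integral_le_of_abs_le _ hLb
  have hpt : ∀ᵐ m ∂η, (∫ x, F.J H m (bc x) ∂(F.taskDataLaw H n m)) - F.J H m (F.expertPolicy m)
      ≤ 2 * (H : ℝ) ^ 2 * (∫ x, lossToError (minEmpLoss φ x) ∂(F.taskDataLaw H n m)
        + 12 * (R * √(Fintype.card A) / √n)) := by
    filter_upwards [hdet] with m hdet
    have := isProbabilityMeasure_sampleLaw F hH m
    have hJi : Integrable (fun x => F.J H m (bc x)) (F.taskDataLaw H n m) :=
      integrable_of_abs_le (hJx m) (hJb m)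
    have herr : Integrable (fun x => errorRate (F.sampleLaw H m) (bc x)) (F.taskDataLaw H n m) :=
      integrable_of_abs_le (B := 1) (measurable_errorRate_cloning h) fun x => by
        have hm := errorRate_mem_Icc (ρ := F.sampleLaw H m) (bc x)
        exact abs_le.2 ⟨by linarith [hm.1], hm.2⟩
    calc _ = ∫ x, (F.J H m (bc x) - F.J H m (F.expertPolicy m)) ∂(F.taskDataLaw H n m) := by
          rw [integral_sub hJi (integrable_const _)]; simp
      _ ≤ ∫ x, 2 * (H : ℝ) ^ 2 * errorRate (F.sampleLaw H m) (bc x) ∂(F.taskDataLaw H n m) := by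
          refine integral_mono (hJi.sub (integrable_const _)) (herr.const_mul _) fun x => ?_
          exact J_sub_le F hH (hC m) hdet ((cloningKernel h).comap (Prod.mk x)
            measurable_prodMk_left)
      _ ≤ _ := by
          rw [integral_const_mul]
          gcongr
          exact integral_errorRate_cloning_le hn hφ hR hR0 h
  rw [← integral_sub hAi hEi, integral_bind_taskDataLaw F hH n η hLm hLb]
  calc _ ≤ ∫ m, 2 * (H : ℝ) ^ 2 * (∫ x, lossToError (minEmpLoss φ x) ∂(F.taskDataLaw H n m)
        + 12 * (R * √(Fintype.card A) / √n)) ∂η :=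
        integral_mono_ae (hAi.sub hEi) ((hLLi.add (integrable_const _)).const_mul _) hpt
    _ = _ := by
        rw [integral_const_mul, integral_add hLLi (integrable_const _)]
        simp

end Tasks

section Representations

variable {S A : Type*} [Fintype A] {d n T : ℕ} {Φ₀ : Set (S → EuclideanSpace ℝ (Fin d))}

/-- The errors associated with the smallest empirical losses of the representations in a class. -/
def representationError (Φ₀ : Set (S → EuclideanSpace ℝ (Fin d))) (φ : Φ₀) (x : Fin n → S × A) :
    ℝ := lossToError (minEmpLoss φ.1 x)

lemma rademacherAverage_representationError_le [Countable Φ₀] [Nonempty Φ₀] (hn : 0 < n) {R : ℝ}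
    (hR : ∀ φ ∈ Φ₀, ∀ s, ‖φ s‖ ≤ R) (X : Fin T → Fin n → S × A) :
    rademacherAverage (fun φ t => representationError Φ₀ φ (X t))
      ≤ 6 / √n * ∫ g : Fin d × (Fin T × Fin n) → ℝ,
          (⨆ φ : Φ₀, ∑ k, g k * φ.1 (X k.2.1 k.2.2).1 k.1) ∂(stdNormal _) := by
  have h := rademacherAverage_le_gaussian
    ((Equiv.prodComm (Fin d) (Fin T × Fin n)).trans (Equiv.prodAssoc (Fin T) (Fin n) (Fin d)))
    (fun (φ : Φ₀) t => representationError Φ₀ φ (X t))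
    (fun φ k => φ.1 (X k.2.1 k.2.2).1 k.1) (C := max 1 R) (L := 2 / √n) (by positivity)
    (fun φ t => le_trans (abs_le.2 ⟨by
      linarith [lossToError_nonneg (minEmpLoss_nonneg φ.1 (X t)),
        show representationError Φ₀ φ (X t) = lossToError (minEmpLoss φ.1 (X t)) from rfl],
      lossToError_le_one _⟩) (le_max_left _ _))
    (fun φ k => ((abs_apply_le_norm _ _).trans (hR φ.1 φ.2 _)).trans (le_max_right _ _))
    (fun φ φ' t => lossToError_minEmpLoss_sub_le hn φ.1 φ'.1 (X t))
  refine h.trans (le_of_eq ?_)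
  ring

variable [MeasurableSpace A] [MeasurableSingletonClass A]

/-- The empirical errors of a minimizer of the bi-level loss are at most `γ` on average if some
representation has losses at most `-log (1 - γ)`. -/
lemma mean_lossToError_minimizer_le (hT : 0 < T) {γ : ℝ} (hγ : γ < 1) {X : Fin T → Fin n → S × A}
    {φ φ' : S → EuclideanSpace ℝ (Fin d)} (hle : bilevelLoss X φ ≤ bilevelLoss X φ')
    (hφ' : ∀ t, minEmpLoss φ' (X t) ≤ -Real.log (1 - γ)) :
    ∑ t, lossToError (minEmpLoss φ (X t)) ≤ T * γ := by
  have hT' : (0 : ℝ) < T := by exact_mod_cast hT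
  have h2 : bilevelLoss X φ' ≤ -Real.log (1 - γ) := by
    rw [bilevelLoss_eq, one_div, inv_mul_le_iff₀ hT']
    simpa using Finset.sum_le_sum (s := Finset.univ) fun t _ => hφ' t
  have h3 := (mean_lossToError_le hT fun t => minEmpLoss φ (X t)).trans
    (lossToError_mono ((bilevelLoss_eq X φ).symm.le.trans (hle.trans h2)))
  rw [lossToError, neg_neg, Real.exp_log (by linarith), one_div, inv_mul_le_iff₀ hT'] at h3
  linarith

variable [MeasurableSpace S]

lemma mean_sub_sum_minEmpLoss_le_deviation {Q : Measure (Fin n → S × A)} [IsProbabilityMeasure Q]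
    (hn : 0 < n) (hm : ∀ φ ∈ Φ₀, Measurable φ) {φ : S → EuclideanSpace ℝ (Fin d)}
    {u : ℕ → S → EuclideanSpace ℝ (Fin d)} (hu : ∀ k, u k ∈ Φ₀)
    (hlim : ∀ s, Tendsto (fun k => u k s) atTop (𝓝 (φ s))) (X : Fin T → Fin n → S × A) :
    T * ∫ x, lossToError (minEmpLoss φ x) ∂Q - ∑ t, lossToError (minEmpLoss φ (X t))
      ≤ deviation Q (representationError Φ₀) X := by
  have hpt : ∀ x : Fin n → S × A, Tendsto (fun k => lossToError (minEmpLoss (u k) x)) atTop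
      (𝓝 (lossToError (minEmpLoss φ x))) := fun x =>
    (continuous_lossToError.tendsto _).comp (tendsto_minEmpLoss hn hlim x)
  have hint : Tendsto (fun k => ∫ x, lossToError (minEmpLoss (u k) x) ∂Q) atTop
      (𝓝 (∫ x, lossToError (minEmpLoss φ x) ∂Q)) := by
    refine tendsto_integral_of_dominated_convergence (fun _ => 1) (fun k =>
      (continuous_lossToError.measurable.comp
        (measurable_minEmpLoss hn (hm _ (hu k)))).aestronglyMeasurable) (integrable_const _)
      (fun k => ae_of_all _ fun x => ?_) (ae_of_all _ hpt)
    rw [Real.norm_of_nonneg (lossToError_nonneg (minEmpLoss_nonneg _ _))]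
    exact lossToError_le_one _
  refine le_of_tendsto' ((hint.const_mul (T : ℝ)).sub (tendsto_finsetSum _ fun t _ => hpt (X t)))
    fun k => ?_
  exact le_deviation (P := Q) (f := representationError Φ₀)
    (fun φ x => lossToError_nonneg (minEmpLoss_nonneg _ _)) (fun φ x => lossToError_le_one _)
    ⟨u k, hu k⟩ X

end Representations

end BehavioralCloning

end

open BehavioralCloning

theorem theorem1 :
    ∃ c c' c'' : ℝ, 0 < c ∧ 0 < c' ∧ 0 < c'' ∧
      ∀ (M S A : Type*) [MeasurableSpace M] [MeasurableSpace S]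
        [Fintype A] [MeasurableSpace A] [MeasurableSingletonClass A]
        (F : BehavioralCloning.TaskFamily M S A) (η : Measure M) [IsProbabilityMeasure η]
        (H n T d : ℕ) (R γ δ : ℝ) (Φ : Set (S → EuclideanSpace ℝ (Fin d))),
        1 ≤ H → 1 ≤ n → 1 ≤ T →
        -- costs are bounded by one
        (∀ m s a, |F.cost m s a| ≤ 1) →
        -- representations are bounded by `R`
        BehavioralCloning.PointwiseMeasurable Φ →
        (∀ φ ∈ Φ, ∀ s, ‖φ s‖ ≤ R) →
        -- the expert policies are deterministic
        (∀ᵐ m ∂η, ∀ s, ∃ a, F.expertPolicy m s = Measure.dirac a) →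
        -- policy realizability
        γ < 1 / 2 →
        (∃ φ₀ ∈ Φ, ∀ᵐ m ∂η, ∃ π ∈ BehavioralCloning.policyClass A φ₀, ∀ s a,
          (∀ b, (F.expertPolicy m s).real {b} ≤ (F.expertPolicy m s).real {a}) →
            1 - γ ≤ (π s).real {a}) →
        0 < δ → δ < 1 →
        -- up to an event of probability at most `δ`, the bound holds for every minimizer
        F.trainDataLaw η H n T {X | ¬ ∀ φ ∈ Φ,
          IsMinOn (BehavioralCloning.bilevelLoss X) Φ φ →
          ∀ bc : (Fin n → S × A) → S → Measure A, BehavioralCloning.IsCloning φ bc →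
            (∫ m, ∫ x, F.J H m (bc x) ∂(F.taskDataLaw H n m) ∂η)
                - ∫ m, F.J H m (F.expertPolicy m) ∂η
              ≤ (H : ℝ) ^ 2 * (2 * γ
                + (c * BehavioralCloning.gaussianAverage Φ
                      (fun k : Fin T × Fin n => (X k.1 k.2).1) / (T * √n)
                  + c' * (R * √(Fintype.card A) / √n)
                  + c'' * √(Real.log (4 / δ) / T)))}
          ≤ ENNReal.ofReal δ := by
  refine ⟨24, 24, 6, by norm_num, by norm_num, by norm_num, ?_⟩
  intro M S A _ _ _ _ _ F η _ H n T d R γ δ Φ hH hn hT hC hPM hR hdet hγ hreal hδ0 hδ1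
  obtain ⟨hΦm, Φ₀, hsub, hcount, hdense⟩ := hPM
  obtain ⟨φ₀, hφ₀, hreal⟩ := hreal
  obtain ⟨m₀, hm₀⟩ := hdet.exists
  have hS : Nonempty S := (F.init m₀).nonempty_of_neZero
  obtain ⟨s₀⟩ := hS
  have hA : Nonempty A := ⟨(hm₀ s₀).choose⟩
  have hR0 : 0 ≤ R := (norm_nonneg _).trans (hR φ₀ hφ₀ s₀)
  have : Countable Φ₀ := hcount.to_subtype
  have : Nonempty Φ₀ := by
    obtain ⟨u, hu, -⟩ := hdense φ₀ hφ₀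
    exact ⟨⟨u 0, hu 0⟩⟩
  have hm₀ : ∀ φ ∈ Φ₀, Measurable φ := fun φ hφ => hΦm φ (hsub hφ)
  have hT' : (0 : ℝ) < T := by exact_mod_cast hT
  set Q := η.bind (F.taskDataLaw H n) with hQ
  have hQp : IsProbabilityMeasure Q := isProbabilityMeasure_bind_taskDataLaw F hH n η
  have hlog : 0 ≤ Real.log (4 / δ) := Real.log_nonneg (by rw [le_div_iff₀ hδ0]; linarith)
  set u : ℝ := 3 * √(T * Real.log (4 / δ)) with hu
  have hae : ∀ᵐ X ∂(F.trainDataLaw η H n T), ∀ t, minEmpLoss φ₀ (X t) ≤ -Real.log (1 - γ) :=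
    ae_all_iff.2 fun t => (measurePreserving_eval (fun _ : Fin T => Q) t).quasiMeasurePreserving.ae
      (ae_minEmpLoss_le F hH hn η (hΦm φ₀ hφ₀) (by linarith) hdet hreal)
  have hdev : F.trainDataLaw η H n T {X | u ≤ deviation Q (representationError Φ₀) X
      - 2 * rademacherAverage fun φ t => representationError Φ₀ φ (X t)} ≤ ENNReal.ofReal δ := by
    refine (measure_deviation_ge_le (P := Q) (f := representationError Φ₀) hT
      (fun φ => continuous_lossToError.measurable.comp (measurable_minEmpLoss hn (hm₀ φ.1 φ.2)))
      (fun φ x => lossToError_nonneg (minEmpLoss_nonneg _ _)) (fun φ x => lossToError_le_one _)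
      (by positivity)).trans (ENNReal.ofReal_le_ofReal ?_)
    have hexp : -2 * u ^ 2 / (T * 3 ^ 2) = -2 * Real.log (4 / δ) := by
      rw [hu, mul_pow, Real.sq_sqrt (by positivity)]
      field_simp
    rw [hexp]
    calc Real.exp (-2 * Real.log (4 / δ)) ≤ Real.exp (-Real.log (4 / δ)) := by
          gcongr
          linarith
      _ = δ / 4 := by rw [Real.exp_neg, Real.exp_log (by positivity), inv_div]
      _ ≤ δ := by linarith
  refine le_trans (measure_mono_ae ?_) hdev
  filter_upwards [hae] with X hX hbad
  by_contra hgood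
  refine hbad fun φ hφ hmin bc hbc => ?_
  change ¬ (u ≤ _) at hgood
  rw [not_le] at hgood
  obtain ⟨v, hv, hlim⟩ := hdense φ hφ
  set G := gaussianAverage Φ (fun k : Fin T × Fin n => (X k.1 k.2).1) with hG
  set L := ∫ x, lossToError (minEmpLoss φ x) ∂Q with hL
  have h1 := mean_sub_sum_minEmpLoss_le_deviation (Q := Q) hn hm₀ hv hlim X
  have h2 := rademacherAverage_representationError_le hn (fun φ hφ => hR φ (hsub hφ)) X
  rw [← gaussianAverage_eq_of_dense hsub ⟨φ₀, hφ₀⟩ hR hdense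
    (fun k : Fin T × Fin n => (X k.1 k.2).1)] at h2
  have h3 := mean_lossToError_minimizer_le hT (by linarith) (hmin hφ₀) hX
  have h4 := regret_cloning_le F hH hn η hC hdet (hΦm φ hφ) (hR φ hφ) hR0 hbc
  refine h4.trans ?_
  have h5 : L ≤ γ + 12 * G / (T * √n) + 3 * √(Real.log (4 / δ) / T) := by
    have h6 : T * L ≤ T * γ + (u + 2 * (6 / √n * G)) := by linarith
    have h7 : u = T * (3 * √(Real.log (4 / δ) / T)) := by
      rw [hu, show (T : ℝ) * Real.log (4 / δ) = T ^ 2 * (Real.log (4 / δ) / T) by field_simp,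
        Real.sqrt_mul (by positivity), Real.sqrt_sq hT'.le]
      ring
    have h8 : 2 * (6 / √n * G) = T * (12 * G / (T * √n)) := by
      field_simp
      ring
    rw [h7, h8] at h6
    refine le_of_mul_le_mul_left (h6.trans (le_of_eq ?_)) hT'
    ring
  have hH2 : (0 : ℝ) ≤ 2 * (H : ℝ) ^ 2 := by positivity
  refine (mul_le_mul_of_nonneg_left (add_le_add_left h5 _) hH2).trans (le_of_eq ?_)
  ring
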